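/- **Setting.** Let $d\ge 1$, $\alpha>1/2$, and let $\gamma=(\gamma_u)_{u\subseteq\{1,\dots,d\}}$ be downward-closed weights: $0<\gamma_v\le\gamma_w\le1$ whenever $w\subseteq v$. For $h\in\mathbb Z^d$ let $\operatorname{supp}h=\{j:h_j\ne0\}$ and $r_{2\alpha,\gamma}(h)=\gamma_{\operatorname{supp}h}^{-1}\prod_{j\in\operatorname{supp}h}|h_j|^{2\alpha}$. The weighted Korobov space $\mathcal H_{d,\alpha,\gamma}$ consists of the continuous functions $f:\mathbb R^d\to\mathbb C$, one-periodic in each variable, with $\|f\|_{d,\alpha,\gamma}^2=\sum_{h\in\mathbb Z^d}|\widehat f(h)|^2r_{2\alpha,\gamma}(h)<\infty$. Put $\mathcal A_d(L)=\{h\in\mathbb Z^d:\prod_{j\in\operatorname{supp}h}|h_j|<L\}$, $\mathcal A_{d,\alpha,\gamma}(L)=\{h\in\mathbb Z^d:r_{2\alpha,\gamma}(h)<L^{2\alpha}\}$, and $\zeta(q)=\sum_{n\ge1}n^{-q}$. **Algorithm.** Let $N$ be an odd prime and $R$ an odd positive integer. For $r=1,\dots,R$ draw, all independently, $z_r$ uniformly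 from $\{1,\dots,N-1\}^d$ and $\Delta_r$ uniformly from $[0,1)^d$, and let $$\widehat f_r(h)=\frac1N\sum_{k=0}^{N-1}f\Big(\Big\{\frac{kz_r}{N}+\Delta_r\Big\}\Big)\exp\Big(-2\pi i\,h\cdot\Big(\frac{kz_r}{N}+\Delta_r\Big)\Big).$$ Order $\mathcal A_d(N/2)$ so that $\operatorname{median}_r|\widehat f_r(h)|^2$ is descending, with ties broken in any way, and let $K_N$ be the set of the first $N$ elements. The output is $A(f)(x)=\sum_{h\in K_N}\operatorname{median}_r\big(\widehat f_r(h)\big)\exp(2\pi i\,h\cdot x)$, where the median of complex numbers is taken separately for real and imaginary parts. The algorithm does not use $\alpha$ or $\gamma$. **Quantities.** Let $$N_*=\sup\Big\{L\ge0:|\mathcal A_{d,\alpha,\gamma}(L)|\le\frac{N-1}{16}\Big\},\qquad T_{\alpha,\lambda}(\gamma)=\sum_{u\subseteq\{1,\dots,d\}}\gamma_u^\lambda(2\zeta(2\alpha\lambda))^{|u|},$$ $$\Sigma_\alpha(\gamma)=\sum_{\emptyset\ne u\subseteq\{1,\dots,d\}}\gamma_u^2\big(2^{1+4\alpha}\zeta(4\alpha)\big)^{|u|},\qquad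 \bar r_{\mathrm{sum}}=16\Big(\frac{4\alpha}{N-1}\int_{N_*}^\infty\frac{|\mathcal A_{d,\alpha,\gamma}(L)|}{L^{4\alpha+1}}\,dL+\frac{\Sigma_\alpha(\gamma)}{N^{4\alpha}}\Big).$$ For $\varepsilon\in(0,1)$ consider the condition $$R\ \ge\ 2\max\Big(\frac{\log(3N/\varepsilon)}{\log(4/3)},\ \frac{\log(3N^2)-\log(4\varepsilon)}{\log2}+\frac{\log(1+2\zeta(2))}{\log2}\,d\Big).\tag{$*$}$$ **Claim.** (i) There are absolute constants $C_1,C_2>0$, and constants $C_{1,\alpha,\lambda},C_{2,\alpha,\lambda}>0$ depending only on $\alpha$ and $\lambda$, such that for all $d$, $\alpha$, $\gamma$ as above, all $f\in\mathcal H_{d,\alpha,\gamma}$, all $\varepsilon\in(0,1)$, and all odd primes $N$ and odd $R$ satisfying $(*)$, the following holds. With $$B=\|f\|_{d,\alpha,\gamma}^2\frac{C_1}{N_*^{2\alpha}}\Big(1+C_2\sqrt{N_*^{4\alpha}\bar r_{\mathrm{sum}}}\Big),$$ $$B_\lambda=\|f\|_{d,\alpha,\gamma}^2\frac{C_{1,\alpha,\lambda}\,T_{\alpha,\lambda}(\gamma)^{1/\lambda}}{N^{1/\lambda}}\Big(1+C_{2,\alpha,\lambda}\sqrt{N^{2\alpha\lambda-1}T_{\alpha,\lambda}(\gamma)+\Sigma_\alpha(\gamma)}\Big),$$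 with probability at least $1-\varepsilon$ one has $\|f-A(f)\|_{L_2}^2\le B$ and, simultaneously for all $\lambda\in(1/(2\alpha),2)$, $\|f-A(f)\|_{L_2}^2\le B_\lambda$. Moreover, if $N_*<N/2$ or $\gamma_\emptyset=1$, then $B\le B_\lambda$ for all $\lambda\in(1/(2\alpha),2)$. (ii) (Near-optimal rates.) For all $d,\alpha,\gamma$ as above and every $\delta>0$ there is a constant $C$ such that for all $f\in\mathcal H_{d,\alpha,\gamma}$, all $\varepsilon\in(0,1)$, and all odd primes $N$ and odd $R$ satisfying $(*)$, with probability at least $1-\varepsilon$, $\|f-A(f)\|_{L_2}^2\le C\|f\|_{d,\alpha,\gamma}^2N^{-2(\alpha-\delta)}$. (iii) (Polynomial tractability.) Let $\alpha>1/2$, $\lambda\in(1/(2\alpha),2)$, $q>0$, and for each $d\ge1$ let $\gamma^{(d)}$ be downward-closed weights as above, with $$\sup_{d\ge1}d^{-q}\,T_{\alpha,\lambda}(\gamma^{(d)})<\infty,\qquad \sup_{d\ge1}d^{-q}\sum_{u\subseteq\{1,\dots,d\}}(\gamma^{(d)}_u)^2\big(2^{1+4\alpha}\zeta(4\alpha)\big)^{|u|}<\infty.$$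 Then there are $C,p,p'>0$ such that for all $d\ge1$ and all $\delta,\varepsilon\in(0,1)$ there are an odd prime $N\le C\,d^{p}\,\delta^{-p'}$ and an odd $R\le C(\log(N/\varepsilon)+d)$ satisfying $(*)$ such that, for every $f\in\mathcal H_{d,\alpha,\gamma^{(d)}}$ with $\|f\|_{d,\alpha,\gamma^{(d)}}\le1$, with probability at least $1-\varepsilon$, $\|f-A(f)\|_{L_2}\le\delta$. -/

import Mathlib

namespace MedianLattice

open MeasureTheory UnitAddTorus

noncomputable section

/-! Functions that are one-periodic in each of `d` real variables are functions on the torus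
`UnitAddTorus (Fin d) = (ℝ/ℤ)^d`; the Fourier character with frequency `h` is `mFourier h`, and the
Fourier coefficient of `f` at `h` is `mFourierCoeff f h`. -/

/-- The uniform distribution on `[0,1)^d`: the Haar probability measure of the torus. -/
def torusMeasure (d : ℕ) : Measure (UnitAddTorus (Fin d)) :=
  Measure.pi fun _ => (AddCircle.haarAddCircle : Measure UnitAddCircle)

/-! ### Weights and the weighted Korobov space -/

/-- Downward-closed weights with values in `(0, 1]`. -/
structure IsWeight {d : ℕ} (γ : Finset (Fin d) → ℝ) : Prop where
  pos : ∀ u, 0 < γ u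
  le_one : ∀ u, γ u ≤ 1
  anti : ∀ v w, w ⊆ v → γ v ≤ γ w

/-- The support of a frequency. -/
def hsupp {d : ℕ} (h : Fin d → ℤ) : Finset (Fin d) :=
  Finset.univ.filter fun j => h j ≠ 0

/-- The function `r_{2α,γ}(h) = γ_{supp h}⁻¹ ∏_{j ∈ supp h} |h_j|^{2α}`. -/
def rKor {d : ℕ} (α : ℝ) (γ : Finset (Fin d) → ℝ) (h : Fin d → ℤ) : ℝ :=
  (γ (hsupp h))⁻¹ * ∏ j ∈ hsupp h, |(h j : ℝ)| ^ (2 * α)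

/-- `f` belongs to the weighted Korobov space. For `α > 1/2` and positive weights each class of
square-integrable functions with finite Korobov norm has exactly one continuous member, the pointwise
sum of its Fourier series; the space consists of these functions. -/
structure MemKorobov {d : ℕ} (α : ℝ) (γ : Finset (Fin d) → ℝ) (f : UnitAddTorus (Fin d) → ℂ) :
    Prop where
  continuous : Continuous f
  summable : Summable fun h : Fin d → ℤ => ‖mFourierCoeff f h‖ ^ 2 * rKor α γ h

/-- The squared Korobov norm. -/
def normSqKor {d : ℕ} (α : ℝ) (γ : Finset (Fin d) → ℝ) (f : UnitAddTorus (Fin d) → ℂ) : ℝ :=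
  ∑' h : Fin d → ℤ, ‖mFourierCoeff f h‖ ^ 2 * rKor α γ h

/-! ### The median lattice algorithm -/

/-- The hyperbolic cross `A_d(L)`. -/
def cross (d : ℕ) (L : ℝ) : Set (Fin d → ℤ) :=
  {h | ∏ j ∈ hsupp h, |(h j : ℝ)| < L}

/-- The median of `R` real numbers, for odd `R`: the middle entry of the sorted list. -/
def median {R : ℕ} (x : Fin R → ℝ) : ℝ :=
  if hR : 0 < R then x (Tuple.sort x ⟨R / 2, Nat.div_lt_self hR one_lt_two⟩) else 0

/-- The median of complex numbers, taken separately for real and imaginary parts. -/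
def cmedian {R : ℕ} (Z : Fin R → ℂ) : ℂ :=
  ⟨median fun r => (Z r).re, median fun r => (Z r).im⟩

/-- The random input of one lattice rule: a generating vector and a shift. -/
abbrev Draw (d : ℕ) : Type := (Fin d → ℕ) × UnitAddTorus (Fin d)

/-- Generating vector uniform on `{1, …, N-1}^d` and shift uniform on `[0,1)^d`, independent. -/
def drawLaw (d N : ℕ) : Measure (Draw d) :=
  (ProbabilityTheory.uniformOn {z : Fin d → ℕ | ∀ j, 1 ≤ z j ∧ z j < N}).prod (torusMeasure d)

/-- The law of the `R` independent draws. -/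
def law (d N R : ℕ) : Measure (Fin R → Draw d) :=
  Measure.pi fun _ => drawLaw d N

/-- The shifted lattice point `{k z / N + Δ}`. -/
def latticePoint {d : ℕ} (N : ℕ) (ω : Draw d) (k : ℕ) : UnitAddTorus (Fin d) :=
  fun j => (((k : ℝ) * (ω.1 j : ℝ) / (N : ℝ) : ℝ) : UnitAddCircle) + ω.2 j

/-- The lattice estimate of the Fourier coefficient of `f` at `h` from one draw. -/
def coeffEst {d : ℕ} (f : UnitAddTorus (Fin d) → ℂ) (N : ℕ) (ω : Draw d) (h : Fin d → ℤ) : ℂ :=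
  (1 / (N : ℂ)) * ∑ k ∈ Finset.range N,
    f (latticePoint N ω k) * mFourier (-h) (latticePoint N ω k)

/-- The median of `|coeffEst|²` over the `R` draws. -/
def medianSq {d R : ℕ} (f : UnitAddTorus (Fin d) → ℂ) (N : ℕ) (ω : Fin R → Draw d)
    (h : Fin d → ℤ) : ℝ :=
  median fun r => ‖coeffEst f N (ω r) h‖ ^ 2

/-- `K` consists of the first `N` elements of `A_d(N/2)` in some ordering for which `medianSq` is in
descending order. Ties can make several sets `K` possible. -/
structure IsSelection {d R : ℕ} (f : UnitAddTorus (Fin d) → ℂ) (N : ℕ) (ω : Fin R → Draw d)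
    (K : Finset (Fin d → ℤ)) : Prop where
  subset : ∀ h ∈ K, h ∈ cross d ((N : ℝ) / 2)
  card : K.card = N
  top : ∀ h ∈ K, ∀ h' ∈ cross d ((N : ℝ) / 2), h' ∉ K → medianSq f N ω h' ≤ medianSq f N ω h

/-- The output of the algorithm, given the selected index set `K`. -/
def approx {d R : ℕ} (f : UnitAddTorus (Fin d) → ℂ) (N : ℕ) (ω : Fin R → Draw d)
    (K : Finset (Fin d → ℤ)) (x : UnitAddTorus (Fin d)) : ℂ :=
  ∑ h ∈ K, cmedian (fun r => coeffEst f N (ω r) h) * mFourier h x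

/-- The squared `L₂` error of the algorithm, given the selected index set `K`. -/
def sqError {d R : ℕ} (f : UnitAddTorus (Fin d) → ℂ) (N : ℕ) (ω : Fin R → Draw d)
    (K : Finset (Fin d → ℤ)) : ℝ :=
  ∫ x, ‖f x - approx f N ω K x‖ ^ 2 ∂(torusMeasure d)

/-- The algorithm can be carried out, and however ties are broken, its squared `L₂` error is at
most `B`. -/
def SqErrorLE {d R : ℕ} (f : UnitAddTorus (Fin d) → ℂ) (N : ℕ) (ω : Fin R → Draw d)
    (B : ℝ) : Prop :=
  (∃ K, IsSelection f N ω K) ∧ ∀ K, IsSelection f N ω K → sqError f N ω K ≤ B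

/-- With probability at least `p`, the property `P` holds. -/
def HoldsWithProb {Ω : Type*} [MeasurableSpace Ω] (μ : Measure Ω) (p : ℝ) (P : Ω → Prop) : Prop :=
  ∃ E : Set Ω, MeasurableSet E ∧ ENNReal.ofReal p ≤ μ E ∧ ∀ ω ∈ E, P ω

/-! ### The quantities in the error bound -/

/-- The weighted hyperbolic cross `A_{d,α,γ}(L)`. -/
def wcross {d : ℕ} (α : ℝ) (γ : Finset (Fin d) → ℝ) (L : ℝ) : Set (Fin d → ℤ) :=
  {h | rKor α γ h < L ^ (2 * α)}

/-- `ζ(q) = ∑_{n ≥ 1} n^{-q}`, for real `q > 1`. -/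
def zetaR (q : ℝ) : ℝ := ∑' n : ℕ, 1 / ((n : ℝ) + 1) ^ q

/-- `T_{α,λ}(γ) = ∑_u γ_u^λ (2 ζ(2αλ))^{|u|}`. -/
def Tsum {d : ℕ} (α lam : ℝ) (γ : Finset (Fin d) → ℝ) : ℝ :=
  ∑ u : Finset (Fin d), γ u ^ lam * (2 * zetaR (2 * α * lam)) ^ u.card

/-- The summand `γ_u² (2^{1+4α} ζ(4α))^{|u|}`. -/
def sqTerm {d : ℕ} (α : ℝ) (γ : Finset (Fin d) → ℝ) (u : Finset (Fin d)) : ℝ :=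
  γ u ^ 2 * ((2 : ℝ) ^ (1 + 4 * α) * zetaR (4 * α)) ^ u.card

/-- `∑_{u ≠ ∅} γ_u² (2^{1+4α} ζ(4α))^{|u|}`. -/
def sqSum {d : ℕ} (α : ℝ) (γ : Finset (Fin d) → ℝ) : ℝ :=
  ∑ u ∈ Finset.univ.erase (∅ : Finset (Fin d)), sqTerm α γ u

/-- `N_* = sup {L ≥ 0 : |A_{d,α,γ}(L)| ≤ (N-1)/16}`. -/
def Nstar {d : ℕ} (α : ℝ) (γ : Finset (Fin d) → ℝ) (N : ℕ) : ℝ :=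
  sSup {L : ℝ | 0 ≤ L ∧ ((wcross α γ L).ncard : ℝ) ≤ ((N : ℝ) - 1) / 16}

/-- The quantity `r̄_sum`. -/
def rSumBar {d : ℕ} (α : ℝ) (γ : Finset (Fin d) → ℝ) (N : ℕ) : ℝ :=
  16 * (4 * α / ((N : ℝ) - 1) *
      (∫ L in Set.Ioi (Nstar α γ N), ((wcross α γ L).ncard : ℝ) / L ^ (4 * α + 1))
    + 1 / (N : ℝ) ^ (4 * α) * sqSum α γ)

/-- The condition that `R` is large enough. -/
def RLarge (d N R : ℕ) (ε : ℝ) : Prop :=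
  2 * max (Real.log (3 * N / ε) / Real.log (4 / 3))
      ((Real.log (3 * (N : ℝ) ^ 2) - Real.log (4 * ε)) / Real.log 2
        + Real.log (1 + 2 * zetaR 2) / Real.log 2 * d) ≤ (R : ℝ)

/-- The first upper bound, in terms of `N_*` and `r̄_sum`. -/
def boundStar {d : ℕ} (C₁ C₂ α : ℝ) (γ : Finset (Fin d) → ℝ) (N : ℕ)
    (f : UnitAddTorus (Fin d) → ℂ) : ℝ :=
  normSqKor α γ f * (C₁ / Nstar α γ N ^ (2 * α))
    * (1 + C₂ * √(Nstar α γ N ^ (4 * α) * rSumBar α γ N))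

/-- The explicit upper bound. -/
def boundExplicit {d : ℕ} (D₁ D₂ α lam : ℝ) (γ : Finset (Fin d) → ℝ) (N : ℕ)
    (f : UnitAddTorus (Fin d) → ℂ) : ℝ :=
  normSqKor α γ f * (D₁ * Tsum α lam γ ^ (1 / lam) / (N : ℝ) ^ (1 / lam))
    * (1 + D₂ * √((N : ℝ) ^ (2 * α * lam - 1) * Tsum α lam γ + sqSum α γ))

end

end MedianLattice

open MedianLattice

/-! For a fixed generating vector `z`, the lattice estimate of the coefficient at `h`, as a function of
the random shift, has the Fourier coefficients `f̂(h + l)` with `l` in the dual lattice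
(`mFourierCoeff_coeffEst`). By Parseval's identity its mean square error is the sum of `|f̂(g)|²` over
the frequencies `g ≠ h` aliased with `h`. Those congruent to `h` modulo `N` are always aliased, every
other one with probability at most `1/(N-1)` (`vectorLaw_inDual_le`).

Let `G` be a set of at most `(N-1)/16` frequencies. With probability at least `15/16` no frequency of
`G` incongruent to `h` is aliased with `h`, and by Markov's inequality the remaining square error is at
most 16 times its mean except with probability `1/16`. So a single draw misses a bound of the order
`(∑_{g ∉ G} |f̂(g)|²)/N + ∑_{g ≡ h, g ≠ h} |f̂(g)|²` with probability at most `1/8`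
(`drawLaw_badDraw_le`). The majority of `R` draws then misses it with probability at most `2^(-R/2)`
(`pi_minority_le`), and the condition on `R` pays for a union bound over the search domain `A_d(N/2)`.

On the complementary event all medians are accurate. A frequency of `G` that is not selected has been
displaced by a selected frequency outside `G` with at least the same median, and `|G| ≤ N = |K|`, so such losses
are at most the energy outside `G`. Frequencies in `A_d(N/2)` are pairwise incongruent modulo `N`, so
the congruence terms add up to at most the energy outside `A_d(N/2)`. Hence the squared error is at most
`200 (∑_{g ∉ G} |f̂(g)|² + ∑_{g ∉ A_d(N/2)} |f̂(g)|²)` (`holdsWithProb_sqErrorLE_energy`).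

For `G = A_{d,α,γ}(N_*)` the first sum is at most `‖f‖² N_*^{-2α}`, and the second one at most
`‖f‖² (2/N)^{2α} max_{u ≠ ∅} γ_u`. All the claimed bounds follow from this one
(`holdsWithProb_sqErrorLE_Nstar`): the maximum is at most `2^{-2α} √Σ_α` and at most `T^{1/λ}`, and the
count `|A_{d,α,γ}(L)| ≤ L^{2αλ} T` gives `N_*^{-2α} ≤ (24 T/N)^{1/λ}` (`inv_Nstar_rpow_le`) and bounds
the integral in `r̄_sum`. -/

namespace MedianLattice

open MeasureTheory UnitAddTorus

/-! ### Fourier analysis of one lattice estimate -/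

instance isProbabilityMeasure_torusMeasure (d : ℕ) : IsProbabilityMeasure (torusMeasure d) := by
  unfold torusMeasure; infer_instance

instance isAddLeftInvariant_torusMeasure (d : ℕ) : (torusMeasure d).IsAddLeftInvariant := by
  unfold torusMeasure; infer_instance

lemma mFourierCoeff_eq_integral_torusMeasure {d : ℕ} (f : UnitAddTorus (Fin d) → ℂ)
    (n : Fin d → ℤ) :
    mFourierCoeff f n = ∫ t, mFourier (-n) t * f t ∂(torusMeasure d) := rfl

lemma integrable_torusMeasure {d : ℕ} {f : UnitAddTorus (Fin d) → ℂ} (hf : Continuous f) :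
    Integrable f (torusMeasure d) :=
  hf.integrable_of_hasCompactSupport (HasCompactSupport.of_compactSpace f)

/-- **Parseval's identity** for continuous functions on the torus. -/
lemma hasSum_sq_mFourierCoeff_of_continuous {d : ℕ} {f : UnitAddTorus (Fin d) → ℂ}
    (hf : Continuous f) :
    HasSum (fun h => ‖mFourierCoeff f h‖ ^ 2) (∫ t, ‖f t‖ ^ 2 ∂(torusMeasure d)) := by
  let F : C(UnitAddTorus (Fin d), ℂ) := ⟨f, hf⟩
  have hs := hasSum_sq_mFourierCoeff (ContinuousMap.toLp 2 (torusMeasure d) ℂ F)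
  have he : ∀ n, mFourierCoeff (ContinuousMap.toLp 2 (torusMeasure d) ℂ F) n = mFourierCoeff f n :=
    fun n => mFourierCoeff_toLp F n
  convert hs using 1
  · exact funext fun n => congrArg (fun c => ‖c‖ ^ 2) (he n).symm
  refine integral_congr_ae ?_
  filter_upwards [ContinuousMap.coeFn_toLp (p := 2) (𝕜 := ℂ) (torusMeasure d) F] with t ht
  exact congrArg (fun c => ‖c‖ ^ 2) ht.symm

lemma mFourierCoeff_sub {d : ℕ} {f g : UnitAddTorus (Fin d) → ℂ} (hf : Continuous f)
    (hg : Continuous g) (n : Fin d → ℤ) :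
    mFourierCoeff (fun x => f x - g x) n = mFourierCoeff f n - mFourierCoeff g n := by
  simp only [mFourierCoeff_eq_integral_torusMeasure, mul_sub]
  exact integral_sub (integrable_torusMeasure ((mFourier (-n)).continuous.mul hf))
    (integrable_torusMeasure ((mFourier (-n)).continuous.mul hg))

lemma mFourierCoeff_const_mul {d : ℕ} (c : ℂ) (f : UnitAddTorus (Fin d) → ℂ) (n : Fin d → ℤ) :
    mFourierCoeff (fun x => c * f x) n = c * mFourierCoeff f n := by
  simp only [mFourierCoeff_eq_integral_torusMeasure, mul_left_comm _ c]
  exact integral_const_mul _ _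

lemma mFourierCoeff_finset_sum {d : ℕ} {ι : Type*} (s : Finset ι)
    {f : ι → UnitAddTorus (Fin d) → ℂ} (hf : ∀ i, Continuous (f i)) (n : Fin d → ℤ) :
    mFourierCoeff (fun x => ∑ i ∈ s, f i x) n = ∑ i ∈ s, mFourierCoeff (f i) n := by
  simp only [mFourierCoeff_eq_integral_torusMeasure, Finset.mul_sum]
  exact integral_finsetSum s fun i _ =>
    integrable_torusMeasure ((mFourier (-n)).continuous.mul (hf i))

lemma mFourier_apply_add {d : ℕ} (n : Fin d → ℤ) (x y : UnitAddTorus (Fin d)) :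
    mFourier n (x + y) = mFourier n x * mFourier n y := by
  simp [mFourier, Finset.prod_mul_distrib, fourier_apply, AddCircle.toCircle_add]

lemma mFourierCoeff_mFourier {d : ℕ} (m n : Fin d → ℤ) :
    mFourierCoeff (mFourier m) n = if n = m then 1 else 0 := by
  have h := (orthonormal_iff_ite.1 (orthonormal_mFourier (d := Fin d))) n m
  rw [← h, ContinuousMap.inner_toLp]
  refine integral_congr_ae (Filter.Eventually.of_forall fun t => ?_)
  simp only [smul_eq_mul]
  rw [mFourier_neg, mul_comm]

/-- Translating by `p` and modulating by `-h` shifts the Fourier coefficients by `h`, up to a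
unimodular factor. -/
lemma mFourierCoeff_translate_modulate {d : ℕ} (f : UnitAddTorus (Fin d) → ℂ)
    (p : UnitAddTorus (Fin d)) (h l : Fin d → ℤ) :
    mFourierCoeff (fun x => f (p + x) * mFourier (-h) (p + x)) l
      = mFourier l p * mFourierCoeff f (h + l) := by
  rw [mFourierCoeff_eq_integral_torusMeasure, mFourierCoeff_eq_integral_torusMeasure,
    ← integral_const_mul,
    ← integral_add_left_eq_self (fun t => mFourier l p * (mFourier (-(h + l)) t * f t)) p]
  congr 1
  ext t
  have h1 : mFourier (-(h + l)) (p + t) = mFourier (-h) (p + t) * mFourier (-l) (p + t) := by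
    rw [neg_add, mFourier_add]
  have h2 : mFourier l p * mFourier (-l) p = 1 := by
    rw [← mFourier_add, add_neg_cancel, mFourier_zero]; rfl
  rw [h1, mFourier_apply_add (-l)]
  linear_combination (mFourier (-l) t * (f (p + t) * mFourier (-h) (p + t))) * (-h2)

/-- Membership in the dual lattice of the rank-one lattice with generating vector `z`: `N ∣ l ⬝ z`. -/
def InDual {d : ℕ} (N : ℕ) (z : Fin d → ℕ) (l : Fin d → ℤ) : Prop :=
  (N : ℤ) ∣ ∑ j, l j * (z j : ℤ)

lemma mFourier_latticePoint_zero {d : ℕ} {N : ℕ} (hN : N ≠ 0) (z : Fin d → ℕ) (l : Fin d → ℤ)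
    (k : ℕ) :
    mFourier l (latticePoint N (z, 0) k)
      = (Complex.exp (2 * Real.pi * Complex.I / N) ^ (∑ j, l j * (z j : ℤ))) ^ k := by
  simp only [mFourier, ContinuousMap.coe_mk, latticePoint, Pi.zero_apply, add_zero,
    fourier_coe_apply]
  rw [← Complex.exp_sum, ← Complex.exp_int_mul, ← Complex.exp_nat_mul]
  congr 1
  have : (N : ℂ) ≠ 0 := by exact_mod_cast hN
  push_cast
  rw [Finset.sum_mul, Finset.mul_sum]
  refine Finset.sum_congr rfl fun j _ => ?_
  field_simp

/-- Orthogonality of characters over the lattice points. -/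
lemma sum_mFourier_latticePoint {d : ℕ} {N : ℕ} (hN : N ≠ 0) (z : Fin d → ℕ) (l : Fin d → ℤ)
    [Decidable (InDual N z l)] :
    ∑ k ∈ Finset.range N, mFourier l (latticePoint N (z, 0) k)
      = if InDual N z l then (N : ℂ) else 0 := by
  have hprim := Complex.isPrimitiveRoot_exp N hN
  simp only [mFourier_latticePoint_zero hN]
  set w := Complex.exp (2 * Real.pi * Complex.I / N) ^ (∑ j, l j * (z j : ℤ)) with hw
  split_ifs with h
  · have : w = 1 := (hprim.zpow_eq_one_iff_dvd _).2 h
    simp [this]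
  · have h1 : w ≠ 1 := fun hh => h ((hprim.zpow_eq_one_iff_dvd _).1 hh)
    have h2 : w ^ N = 1 := by
      rw [hw, ← zpow_natCast, ← zpow_mul, mul_comm (∑ j, _), zpow_mul, zpow_natCast, hprim.pow_eq_one,
        one_zpow]
    rw [geom_sum_eq h1, h2, sub_self, zero_div]

lemma latticePoint_eq_add {d : ℕ} (N : ℕ) (z : Fin d → ℕ) (x : UnitAddTorus (Fin d)) (k : ℕ) :
    latticePoint N (z, x) k = latticePoint N (z, 0) k + x := by
  ext j; simp [latticePoint]

lemma coeffEst_eq {d : ℕ} (f : UnitAddTorus (Fin d) → ℂ) (N : ℕ) (z : Fin d → ℕ)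
    (x : UnitAddTorus (Fin d)) (h : Fin d → ℤ) :
    coeffEst f N (z, x) h = (1 / (N : ℂ)) * ∑ k ∈ Finset.range N,
      f (latticePoint N (z, 0) k + x) * mFourier (-h) (latticePoint N (z, 0) k + x) := by
  unfold coeffEst
  congr 1
  exact Finset.sum_congr rfl fun k _ => by rw [latticePoint_eq_add N z x]

lemma continuous_coeffEst {d : ℕ} {f : UnitAddTorus (Fin d) → ℂ} (hf : Continuous f) (N : ℕ)
    (z : Fin d → ℕ) (h : Fin d → ℤ) : Continuous fun x => coeffEst f N (z, x) h := by
  simp only [coeffEst_eq]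
  fun_prop

/-- Aliasing: as a function of the shift, the lattice estimate of the coefficient at `h` has the
Fourier coefficients of `f` at `h + l`, for `l` in the dual lattice. -/
lemma mFourierCoeff_coeffEst {d : ℕ} {f : UnitAddTorus (Fin d) → ℂ} (hf : Continuous f) {N : ℕ}
    (hN : N ≠ 0) (z : Fin d → ℕ) (h l : Fin d → ℤ) [Decidable (InDual N z l)] :
    mFourierCoeff (fun x => coeffEst f N (z, x) h) l
      = if InDual N z l then mFourierCoeff f (h + l) else 0 := by
  simp only [coeffEst_eq]
  rw [mFourierCoeff_const_mul, mFourierCoeff_finset_sum _ (fun k => by fun_prop)]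
  simp only [mFourierCoeff_translate_modulate]
  rw [← Finset.sum_mul, sum_mFourier_latticePoint hN]
  have : (N : ℂ) ≠ 0 := by exact_mod_cast hN
  split_ifs
  · field_simp
  · simp

lemma mFourierCoeff_const {d : ℕ} (c : ℂ) (l : Fin d → ℤ) :
    mFourierCoeff (fun _ : UnitAddTorus (Fin d) => c) l = if l = 0 then c else 0 := by
  have h1 := mFourierCoeff_const_mul c (mFourier (0 : Fin d → ℤ)) l
  rw [mFourierCoeff_mFourier, mFourier_zero] at h1
  simpa using h1

open Classical in
/-- The mean square error over the random shift, for a fixed generating vector. -/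
lemma lintegral_coeffEst_sub {d : ℕ} {f : UnitAddTorus (Fin d) → ℂ} (hf : Continuous f) {N : ℕ}
    (hN : N ≠ 0) (z : Fin d → ℕ) (h : Fin d → ℤ) :
    ∫⁻ x, ENNReal.ofReal (‖coeffEst f N (z, x) h - mFourierCoeff f h‖ ^ 2) ∂(torusMeasure d)
      = ∑' g, if g ≠ h ∧ InDual N z (g - h)
          then ENNReal.ofReal (‖mFourierCoeff f g‖ ^ 2) else 0 := by
  have hc : Continuous fun x => coeffEst f N (z, x) h - mFourierCoeff f h :=
    (continuous_coeffEst hf N z h).sub continuous_const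
  have hP := hasSum_sq_mFourierCoeff_of_continuous hc
  have hi : Integrable (fun x => ‖coeffEst f N (z, x) h - mFourierCoeff f h‖ ^ 2)
      (torusMeasure d) := by
    have : Continuous fun x => ‖coeffEst f N (z, x) h - mFourierCoeff f h‖ ^ 2 := by fun_prop
    exact this.integrable_of_hasCompactSupport (HasCompactSupport.of_compactSpace _)
  rw [← ofReal_integral_eq_lintegral_ofReal hi (Filter.Eventually.of_forall fun x => by positivity),
    ← hP.tsum_eq, ENNReal.ofReal_tsum_of_nonneg (fun _ => by positivity) hP.summable]
  conv_rhs => rw [← (Equiv.addLeft h).tsum_eq]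
  refine tsum_congr fun l => ?_
  rw [mFourierCoeff_sub (continuous_coeffEst hf N z h) continuous_const,
    mFourierCoeff_coeffEst hf hN, mFourierCoeff_const]
  simp only [Equiv.coe_addLeft, add_sub_cancel_left, ne_eq, add_eq_left]
  by_cases hl : l = 0
  · subst hl
    simp [InDual]
  · by_cases hd : InDual N z l <;> simp [hl, hd]

/-! ### The error of one draw -/

/-- The `ℓ²` mass of the Fourier coefficients of `f` with frequency in `S`. -/
noncomputable def energy {d : ℕ} (f : UnitAddTorus (Fin d) → ℂ) (S : Set (Fin d → ℤ)) : ℝ :=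
  ∑' g, S.indicator (fun g => ‖mFourierCoeff f g‖ ^ 2) g

lemma summable_energy {d : ℕ} {f : UnitAddTorus (Fin d) → ℂ} (hf : Continuous f)
    (S : Set (Fin d → ℤ)) :
    Summable (S.indicator fun g => ‖mFourierCoeff f g‖ ^ 2) :=
  (hasSum_sq_mFourierCoeff_of_continuous hf).summable.indicator S

lemma energy_nonneg {d : ℕ} (f : UnitAddTorus (Fin d) → ℂ) (S : Set (Fin d → ℤ)) :
    0 ≤ energy f S :=
  tsum_nonneg fun _ => Set.indicator_nonneg (fun _ _ => by positivity) _

lemma ofReal_energy {d : ℕ} {f : UnitAddTorus (Fin d) → ℂ} (hf : Continuous f)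
    (S : Set (Fin d → ℤ)) :
    ENNReal.ofReal (energy f S)
      = ∑' g, S.indicator (fun g => ENNReal.ofReal (‖mFourierCoeff f g‖ ^ 2)) g := by
  rw [energy, ENNReal.ofReal_tsum_of_nonneg
    (fun _ => Set.indicator_nonneg (fun _ _ => by positivity) _) (summable_energy hf S)]
  refine tsum_congr fun g => ?_
  by_cases hg : g ∈ S <;> simp [hg]

/-- Frequencies congruent modulo `N` are aliased by every lattice rule with `N` points. -/
def Congr {d : ℕ} (N : ℕ) (g h : Fin d → ℤ) : Prop := ∀ j, (N : ℤ) ∣ g j - h j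

lemma cube_eq_coe (d N : ℕ) : {z : Fin d → ℕ | ∀ j, 1 ≤ z j ∧ z j < N}
    = ((Fintype.piFinset fun _ => Finset.Ico 1 N : Finset (Fin d → ℕ)) : Set (Fin d → ℕ)) := by
  ext z; simp

/-- The law of the generating vector. -/
noncomputable def vectorLaw (d N : ℕ) : Measure (Fin d → ℕ) :=
  ProbabilityTheory.uniformOn {z : Fin d → ℕ | ∀ j, 1 ≤ z j ∧ z j < N}

lemma isProbabilityMeasure_vectorLaw (d : ℕ) {N : ℕ} (hN : 2 ≤ N) :
    IsProbabilityMeasure (vectorLaw d N) := by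
  unfold vectorLaw
  rw [cube_eq_coe]
  refine ProbabilityTheory.isProbabilityMeasure_uniformOn (Finset.finite_toSet _)
    ⟨fun _ => 1, ?_⟩
  simp; omega

lemma isProbabilityMeasure_drawLaw (d : ℕ) {N : ℕ} (hN : 2 ≤ N) :
    IsProbabilityMeasure (drawLaw d N) := by
  have := isProbabilityMeasure_vectorLaw d hN
  exact inferInstanceAs (IsProbabilityMeasure ((vectorLaw d N).prod (torusMeasure d)))

/-- If `l j` is prime to `N`, the other coordinates of `z` leave at most one choice of `z j` for
which `l` is in the dual lattice. -/
lemma vectorLaw_inDual_le {d N : ℕ} (hN : N.Prime) (l : Fin d → ℤ) (hl : ∃ j, ¬ (N : ℤ) ∣ l j) :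
    vectorLaw d N {z | InDual N z l} ≤ ((N - 1 : ℕ) : ENNReal)⁻¹ := by
  classical
  obtain ⟨j, hj⟩ := hl
  set S : Finset (Fin d → ℕ) := Fintype.piFinset fun _ => Finset.Ico 1 N with hS
  have hmem : ∀ z, z ∈ S ↔ ∀ j, 1 ≤ z j ∧ z j < N := fun z => by simp [hS, Fintype.mem_piFinset]
  set B := S.filter fun z => InDual N z l with hB
  have hcount : B.card * (N - 1) ≤ S.card := by
    have : (B ×ˢ Finset.Ico 1 N).card = B.card * (N - 1) := by simp
    rw [← this]
    refine Finset.card_le_card_of_injOn (fun p => Function.update p.1 j p.2) ?_ ?_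
    · rintro ⟨z, a⟩ hp
      simp only [Finset.coe_product, Set.mem_prod, Finset.mem_coe, hB, Finset.mem_filter,
        Finset.mem_Ico] at hp
      rw [Finset.mem_coe, hmem]
      intro i
      by_cases hi : i = j
      · subst hi; simpa using hp.2
      · simpa [hi] using (hmem z).1 hp.1.1 i
    · rintro ⟨z, a⟩ hp ⟨z', a'⟩ hp' he
      simp only [Finset.coe_product, Set.mem_prod, Finset.mem_coe, hB, Finset.mem_filter,
        Finset.mem_Ico] at hp hp' he
      have ha : a = a' := by simpa using congrFun he j
      have hoff : ∀ i, i ≠ j → z i = z' i := fun i hi => by simpa [hi] using congrFun he i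
      have hd : (N : ℤ) ∣ l j * ((z j : ℤ) - z' j) := by
        have h1 := dvd_sub hp.1.2 hp'.1.2
        rw [← Finset.sum_sub_distrib, Finset.sum_eq_single j] at h1
        · rwa [← mul_sub] at h1
        · intro i _ hi; rw [hoff i hi, sub_self]
        · simp
      have hz : z j = z' j := by
        rcases (Nat.prime_iff_prime_int.1 hN).dvd_or_dvd hd with h1 | h1
        · exact absurd h1 hj
        · have hb := (hmem z).1 hp.1.1 j
          have hb' := (hmem z').1 hp'.1.1 j
          have := Int.eq_zero_of_abs_lt_dvd h1 (by rw [abs_lt]; omega)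
          omega
      have : z = z' := by
        ext i
        by_cases hi : i = j
        · rw [hi, hz]
        · exact hoff i hi
      rw [this, ha]
  have hS0 : S.Nonempty := ⟨fun _ => 1, (hmem _).2 fun _ => ⟨le_rfl, hN.one_lt⟩⟩
  have heq : vectorLaw d N {z | InDual N z l} = B.card / S.card := by
    unfold vectorLaw
    rw [cube_eq_coe, ← ProbabilityTheory.uniformOn_inter_self (Finset.finite_toSet _)]
    have : (S : Set (Fin d → ℕ)) ∩ {z | InDual N z l} = (B : Set (Fin d → ℕ)) := by
      ext z; simp [hB]
    rw [this, ProbabilityTheory.uniformOn_apply_finset,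
      Finset.inter_eq_right.2 (Finset.filter_subset _ _)]
  have hN1 : ((N - 1 : ℕ) : ENNReal) ≠ 0 := by
    have := hN.two_le; exact_mod_cast (by omega : N - 1 ≠ 0)
  rw [heq, ENNReal.div_le_iff (by simpa using hS0.ne_empty) (by simp),
    ← ENNReal.mul_le_iff_le_inv hN1 (by simp)]
  exact_mod_cast (mul_comm _ _).trans_le hcount

lemma measurable_coeffEst {d : ℕ} {f : UnitAddTorus (Fin d) → ℂ} (hf : Continuous f) (N : ℕ)
    (h : Fin d → ℤ) : Measurable fun ω : Draw d => coeffEst f N ω h := by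
  have hp : ∀ k, Measurable fun ω : Draw d => latticePoint N ω k := by
    intro k
    refine measurable_pi_lambda _ fun j => ?_
    have h1 : Measurable fun ω : Draw d => (k : ℝ) * (ω.1 j : ℝ) / (N : ℝ) := by
      have : Measurable fun ω : Draw d => ω.1 j := (measurable_pi_apply j).comp measurable_fst
      have : Measurable fun ω : Draw d => ((ω.1 j : ℕ) : ℝ) := measurable_from_top.comp this
      fun_prop
    exact (AddCircle.measurable_mk'.comp h1).add ((measurable_pi_apply j).comp measurable_snd)
  refine (Finset.measurable_fun_sum _ fun k _ => ?_).const_mul _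
  exact (hf.measurable.comp (hp k)).mul ((mFourier (-h)).continuous.measurable.comp (hp k))

/-- Markov's inequality with a strict inequality, valid also for vanishing mean. -/
lemma measure_sixteen_mul_lt_le {Ω : Type*} [MeasurableSpace Ω] (μ : Measure Ω) {X : Ω → ENNReal}
    (hX : Measurable X) {m : ENNReal} (h : ∫⁻ ω, X ω ∂μ ≤ m) :
    μ {ω | 16 * m < X ω} ≤ 16⁻¹ := by
  rcases eq_or_ne m 0 with rfl | hm
  · have h0 : X =ᵐ[μ] 0 := (lintegral_eq_zero_iff hX).1 (le_antisymm h zero_le)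
    have : μ {ω | 16 * 0 < X ω} = 0 := by
      refine measure_mono_null (fun ω hω => ?_) (ae_iff.1 h0)
      simpa [pos_iff_ne_zero] using hω
    rw [this]; exact zero_le
  rcases eq_or_ne m ⊤ with rfl | hm'
  · simp
  have h1 : 16 * m * μ {ω | 16 * m ≤ X ω} ≤ m :=
    (mul_meas_ge_le_lintegral hX _).trans h
  have h2 : 16 * μ {ω | 16 * m ≤ X ω} ≤ 1 := by
    have : m * (16 * μ {ω | 16 * m ≤ X ω}) ≤ m * 1 := by
      rw [mul_one]; convert h1 using 1; ring
    exact (ENNReal.mul_le_mul_iff_right hm hm').1 this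
  refine (measure_mono fun ω (hω : 16 * m < X ω) => hω.le).trans ?_
  rw [← mul_one (16⁻¹ : ENNReal)]
  exact (ENNReal.mul_le_iff_le_inv (by simp) (by simp)).1 h2

/-- A bound for the square error of the estimate at `h` that one draw satisfies with probability
at least `7/8`, when `G` has at most `(N-1)/16` elements. -/
noncomputable def errBound {d : ℕ} (f : UnitAddTorus (Fin d) → ℂ) (N : ℕ)
    (G : Finset (Fin d → ℤ)) (h : Fin d → ℤ) : ℝ :=
  16 * (energy f {g | g ≠ h ∧ Congr N g h} + energy f (G : Set (Fin d → ℤ))ᶜ / ((N - 1 : ℕ) : ℝ))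

lemma errBound_nonneg {d : ℕ} (f : UnitAddTorus (Fin d) → ℂ) (N : ℕ)
    (G : Finset (Fin d → ℤ)) (h : Fin d → ℤ) : 0 ≤ errBound f N G h := by
  have := energy_nonneg f {g | g ≠ h ∧ Congr N g h}
  have := energy_nonneg f (G : Set (Fin d → ℤ))ᶜ
  unfold errBound; positivity

/-- The event that one draw misses the error bound. -/
def badDraw {d : ℕ} (f : UnitAddTorus (Fin d) → ℂ) (N : ℕ)
    (G : Finset (Fin d → ℤ)) (h : Fin d → ℤ) : Set (Draw d) :=
  {ω | errBound f N G h < ‖coeffEst f N ω h - mFourierCoeff f h‖ ^ 2}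

lemma measurableSet_badDraw {d : ℕ} {f : UnitAddTorus (Fin d) → ℂ} (hf : Continuous f) (N : ℕ)
    (G : Finset (Fin d → ℤ)) (h : Fin d → ℤ) : MeasurableSet (badDraw f N G h) :=
  measurableSet_lt measurable_const
    (((measurable_coeffEst hf N h).sub measurable_const).norm.pow_const 2)

/-- With probability at least `15/16` no frequency of `G` is aliased with `h`, other than those
congruent to `h`. On that event the mean square error consists of the congruent frequencies and of
frequencies outside `G`, each of which is aliased with probability at most `1/(N-1)`. -/
lemma drawLaw_badDraw_le {d N : ℕ} (hN : N.Prime) {f : UnitAddTorus (Fin d) → ℂ}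
    (hf : Continuous f) {G : Finset (Fin d → ℤ)} (hG : 16 * G.card ≤ N - 1) (h : Fin d → ℤ) :
    drawLaw d N (badDraw f N G h) ≤ 8⁻¹ := by
  classical
  have hprob := isProbabilityMeasure_vectorLaw d hN.two_le
  have hN1 : ((N - 1 : ℕ) : ENNReal) ≠ 0 := by
    have := hN.two_le; exact_mod_cast (by omega : N - 1 ≠ 0)
  have hdual : ∀ g, ¬ Congr N g h →
      vectorLaw d N {z | InDual N z (g - h)} ≤ ((N - 1 : ℕ) : ENNReal)⁻¹ := fun g hg =>
    vectorLaw_inDual_le hN _ (by simpa [Congr] using hg)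
  set Z : Set (Fin d → ℕ) := {z | ∃ g ∈ G, ¬ Congr N g h ∧ InDual N z (g - h)} with hZ
  have hZle : vectorLaw d N Z ≤ 16⁻¹ := by
    have hsub : Z ⊆ ⋃ g ∈ G.filter fun g => ¬ Congr N g h, {z | InDual N z (g - h)} := by
      rintro z ⟨g, hg, h1, h2⟩
      simp only [Set.mem_iUnion]
      exact ⟨g, Finset.mem_filter.2 ⟨hg, h1⟩, h2⟩
    calc vectorLaw d N Z ≤ ∑ g ∈ G.filter fun g => ¬ Congr N g h,
          vectorLaw d N {z | InDual N z (g - h)} :=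
          (measure_mono hsub).trans (measure_biUnion_finset_le _ _)
      _ ≤ ∑ g ∈ G.filter fun g => ¬ Congr N g h, ((N - 1 : ℕ) : ENNReal)⁻¹ :=
          Finset.sum_le_sum fun g hg => hdual g (Finset.mem_filter.1 hg).2
      _ ≤ G.card * ((N - 1 : ℕ) : ENNReal)⁻¹ := by
          rw [Finset.sum_const, nsmul_eq_mul]
          gcongr
          exact Finset.filter_subset _ _
      _ ≤ 16⁻¹ := by
          rw [← div_eq_mul_inv, ENNReal.div_le_iff hN1 (by simp),
            ← ENNReal.mul_le_iff_le_inv (by simp) (by simp)]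
          exact_mod_cast hG
  let a : (Fin d → ℤ) → ENNReal := fun g => ENNReal.ofReal (‖mFourierCoeff f g‖ ^ 2)
  let X : Draw d → ENNReal := (Zᶜ ×ˢ Set.univ).indicator fun ω =>
    ENNReal.ofReal (‖coeffEst f N ω h - mFourierCoeff f h‖ ^ 2)
  have hXm : Measurable X :=
    (((measurable_coeffEst hf N h).sub measurable_const).norm.pow_const 2).ennreal_ofReal.indicator
      ((Set.to_countable Zᶜ).measurableSet.prod MeasurableSet.univ)
  have hXint : ∫⁻ ω, X ω ∂(drawLaw d N) ≤ ENNReal.ofReal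
      (energy f {g | g ≠ h ∧ Congr N g h} + energy f (G : Set (Fin d → ℤ))ᶜ / ((N - 1 : ℕ) : ℝ)) := by
    have h1 : ∀ z, ∫⁻ x, X (z, x) ∂(torusMeasure d) ≤ ∑' g,
        ({g | g ≠ h ∧ Congr N g h}.indicator a g + (G : Set (Fin d → ℤ))ᶜ.indicator a g *
          {z | ¬ Congr N g h ∧ InDual N z (g - h)}.indicator 1 z) := by
      intro z
      by_cases hz : z ∈ Z
      · simp [X, hz]
      · have : ∀ x, X (z, x) = ENNReal.ofReal (‖coeffEst f N (z, x) h - mFourierCoeff f h‖ ^ 2) :=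
          fun x => Set.indicator_of_mem (by simp [hz]) _
        simp only [this]
        rw [lintegral_coeffEst_sub hf hN.ne_zero]
        refine ENNReal.tsum_le_tsum fun g => ?_
        split_ifs with hg
        · by_cases hc : Congr N g h
          · simp [hg.1, hc, a]
          · have hgG : g ∉ G := fun hgG => hz ⟨g, hgG, hc, hg.2⟩
            simp [hc, hgG, hg.2, a]
        · exact zero_le
    calc ∫⁻ ω, X ω ∂(drawLaw d N) = ∫⁻ z, ∫⁻ x, X (z, x) ∂(torusMeasure d) ∂(vectorLaw d N) :=
          lintegral_prod X hXm.aemeasurable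
      _ ≤ ∫⁻ z, ∑' g,
          ({g | g ≠ h ∧ Congr N g h}.indicator a g + (G : Set (Fin d → ℤ))ᶜ.indicator a g *
          {z | ¬ Congr N g h ∧ InDual N z (g - h)}.indicator 1 z) ∂(vectorLaw d N) :=
          lintegral_mono h1
      _ = ∑' g, ({g | g ≠ h ∧ Congr N g h}.indicator a g + (G : Set (Fin d → ℤ))ᶜ.indicator a g *
          vectorLaw d N {z | ¬ Congr N g h ∧ InDual N z (g - h)}) := by
          rw [lintegral_tsum fun g => (measurable_of_countable _).aemeasurable]
          refine tsum_congr fun g => ?_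
          rw [lintegral_add_left measurable_const,
            lintegral_const_mul _ (measurable_of_countable _),
            lintegral_indicator_one (Set.to_countable _).measurableSet, lintegral_const]
          simp
      _ ≤ ∑' g, ({g | g ≠ h ∧ Congr N g h}.indicator a g + (G : Set (Fin d → ℤ))ᶜ.indicator a g *
          ((N - 1 : ℕ) : ENNReal)⁻¹) := by
          gcongr with g
          by_cases hc : Congr N g h
          · simp [hc]
          · simpa [hc] using hdual g hc
      _ = _ := by
          have hN2 : (0 : ℝ) < ((N - 1 : ℕ) : ℝ) := by
            have := hN.two_le; exact_mod_cast (by omega : 0 < N - 1)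
          rw [ENNReal.tsum_add, ENNReal.tsum_mul_right, ENNReal.ofReal_add (energy_nonneg _ _)
            (div_nonneg (energy_nonneg _ _) hN2.le), ENNReal.ofReal_div_of_pos hN2,
            ofReal_energy hf, ofReal_energy hf, ENNReal.ofReal_natCast, div_eq_mul_inv]
  have hsub : badDraw f N G h ⊆ (Z ×ˢ Set.univ) ∪ {ω | 16 * ENNReal.ofReal
      (energy f {g | g ≠ h ∧ Congr N g h} + energy f (G : Set (Fin d → ℤ))ᶜ / ((N - 1 : ℕ) : ℝ))
        < X ω} := by
    intro ω hω
    by_cases hz : ω.1 ∈ Z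
    · exact Or.inl ⟨hz, trivial⟩
    · refine Or.inr ?_
      have : X ω = ENNReal.ofReal (‖coeffEst f N ω h - mFourierCoeff f h‖ ^ 2) :=
        Set.indicator_of_mem (by simp [hz]) _
      rw [Set.mem_ofPred_eq, this]
      have h16 : (16 : ENNReal) = ENNReal.ofReal 16 := by simp
      rw [h16, ← ENNReal.ofReal_mul (by norm_num)]
      exact (ENNReal.ofReal_lt_ofReal_iff_of_nonneg (errBound_nonneg f N G h)).2 hω
  calc drawLaw d N (badDraw f N G h)
      ≤ drawLaw d N (Z ×ˢ Set.univ) + drawLaw d N _ :=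
        (measure_mono hsub).trans (measure_union_le _ _)
    _ ≤ 16⁻¹ + 16⁻¹ := by
        refine add_le_add ?_ (measure_sixteen_mul_lt_le _ hXm hXint)
        change ((vectorLaw d N).prod (torusMeasure d)) (Z ×ˢ Set.univ) ≤ 16⁻¹
        rw [Measure.prod_prod, measure_univ, mul_one]
        exact hZle
    _ = 8⁻¹ := by
        rw [← two_mul, show (16 : ENNReal) = 2 * 8 by norm_num,
          ENNReal.mul_inv (by simp) (by simp), ← mul_assoc,
          ENNReal.mul_inv_cancel (by simp) (by simp), one_mul]

/-! ### Medians -/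

lemma majority_mono {R : ℕ} {p q : Fin R → Prop} [DecidablePred p] [DecidablePred q]
    (h : R < 2 * (Finset.univ.filter p).card) (hpq : ∀ r, p r → q r) :
    R < 2 * (Finset.univ.filter q).card :=
  h.trans_le (Nat.mul_le_mul_left 2
    (Finset.card_le_card (Finset.monotone_filter_right _ fun r _ hr => hpq r hr)))

lemma median_le_of_majority {R : ℕ} {x : Fin R → ℝ} {b : ℝ}
    (h : R < 2 * (Finset.univ.filter fun r => x r ≤ b).card) : median x ≤ b := by
  have hR : 0 < R := by
    rcases Nat.eq_zero_or_pos R with rfl | hR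
    · simp at h
    · exact hR
  rw [median, dif_pos hR]
  by_contra! hb
  set m : Fin R := ⟨R / 2, Nat.div_lt_self hR one_lt_two⟩ with hm
  have hsub : (Finset.univ.filter fun r => x r ≤ b) ⊆ (Finset.Iio m).image (Tuple.sort x) := by
    intro r hr
    refine Finset.mem_image.2 ⟨(Tuple.sort x).symm r, ?_, by simp⟩
    rw [Finset.mem_Iio]
    by_contra! hle
    have h1 := Tuple.monotone_sort x hle
    simp only [Function.comp_apply, Equiv.apply_symm_apply] at h1
    exact absurd (h1.trans (Finset.mem_filter.1 hr).2) (not_le.2 hb)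
  have hc := (Finset.card_le_card hsub).trans Finset.card_image_le
  rw [Fin.card_Iio, hm] at hc
  simp only at hc
  omega

lemma le_median_of_majority {R : ℕ} {x : Fin R → ℝ} {b : ℝ}
    (h : R < 2 * (Finset.univ.filter fun r => b ≤ x r).card) : b ≤ median x := by
  have hR : 0 < R := by
    rcases Nat.eq_zero_or_pos R with rfl | hR
    · simp at h
    · exact hR
  rw [median, dif_pos hR]
  by_contra! hb
  set m : Fin R := ⟨R / 2, Nat.div_lt_self hR one_lt_two⟩ with hm
  have hsub : (Finset.univ.filter fun r => b ≤ x r) ⊆ (Finset.Ioi m).image (Tuple.sort x) := by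
    intro r hr
    refine Finset.mem_image.2 ⟨(Tuple.sort x).symm r, ?_, by simp⟩
    rw [Finset.mem_Ioi]
    by_contra! hle
    have h1 := Tuple.monotone_sort x hle
    simp only [Function.comp_apply, Equiv.apply_symm_apply] at h1
    exact absurd ((Finset.mem_filter.1 hr).2.trans h1) (not_le.2 hb)
  have hc := (Finset.card_le_card hsub).trans Finset.card_image_le
  rw [Fin.card_Ioi, hm] at hc
  simp only at hc
  omega

lemma sq_sub_median_le {R : ℕ} {x : Fin R → ℝ} {c e : ℝ} (he : 0 ≤ e)
    (h : R < 2 * (Finset.univ.filter fun r => (x r - c) ^ 2 ≤ e).card) :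
    (median x - c) ^ 2 ≤ e := by
  have hkey : ∀ t, t ^ 2 ≤ e ↔ |t| ≤ √e := fun t => by
    rw [← Real.sqrt_sq_eq_abs, Real.sqrt_le_sqrt_iff he]
  rw [hkey, abs_le]
  constructor
  · have : c - √e ≤ median x := le_median_of_majority (majority_mono h fun r hr => by
        have := (abs_le.1 ((hkey _).1 hr)).1
        linarith)
    linarith
  · have : median x ≤ c + √e := median_le_of_majority (majority_mono h fun r hr => by
        have := (abs_le.1 ((hkey _).1 hr)).2
        linarith)
    linarith

/-- Passing to the real and imaginary parts costs a factor `2`. -/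
lemma norm_cmedian_sub_sq_le {R : ℕ} {Z : Fin R → ℂ} {c : ℂ} {e : ℝ} (he : 0 ≤ e)
    (h : R < 2 * (Finset.univ.filter fun r => ‖Z r - c‖ ^ 2 ≤ e).card) :
    ‖cmedian Z - c‖ ^ 2 ≤ 2 * e := by
  have hn : ∀ w : ℂ, ‖w‖ ^ 2 = w.re ^ 2 + w.im ^ 2 := fun w => by
    rw [Complex.sq_norm, Complex.normSq_apply]; ring
  have h1 : (median (fun r => (Z r).re) - c.re) ^ 2 ≤ e :=
    sq_sub_median_le he (majority_mono h fun r hr => by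
        simp only [hn, Complex.sub_re, Complex.sub_im] at hr
        nlinarith [sq_nonneg ((Z r).im - c.im)])
  have h2 : (median (fun r => (Z r).im) - c.im) ^ 2 ≤ e :=
    sq_sub_median_le he (majority_mono h fun r hr => by
        simp only [hn, Complex.sub_re, Complex.sub_im] at hr
        nlinarith [sq_nonneg ((Z r).re - c.re)])
  rw [hn]
  simp only [cmedian, Complex.sub_re, Complex.sub_im]
  linarith

lemma norm_sq_le_two_mul_add (u v : ℂ) : ‖u‖ ^ 2 ≤ 2 * ‖v‖ ^ 2 + 2 * ‖v - u‖ ^ 2 := by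
  have h1 : ‖u‖ ≤ ‖v‖ + ‖v - u‖ := by
    have := norm_sub_le v (v - u)
    rwa [sub_sub_cancel] at this
  nlinarith [norm_nonneg u, norm_nonneg v, norm_nonneg (v - u), sq_nonneg (‖v‖ - ‖v - u‖)]

lemma median_norm_sq_le {R : ℕ} {Z : Fin R → ℂ} {c : ℂ} {e : ℝ}
    (h : R < 2 * (Finset.univ.filter fun r => ‖Z r - c‖ ^ 2 ≤ e).card) :
    median (fun r => ‖Z r‖ ^ 2) ≤ 2 * ‖c‖ ^ 2 + 2 * e :=
  median_le_of_majority (majority_mono h fun r hr => by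
      have := norm_sq_le_two_mul_add (Z r) c
      rw [norm_sub_rev] at this
      linarith)

lemma norm_sq_le_median {R : ℕ} {Z : Fin R → ℂ} {c : ℂ} {e : ℝ}
    (h : R < 2 * (Finset.univ.filter fun r => ‖Z r - c‖ ^ 2 ≤ e).card) :
    ‖c‖ ^ 2 ≤ 2 * median (fun r => ‖Z r‖ ^ 2) + 2 * e := by
  have : ‖c‖ ^ 2 / 2 - e ≤ median fun r => ‖Z r‖ ^ 2 :=
    le_median_of_majority (majority_mono h fun r hr => by
        have := norm_sq_le_two_mul_add c (Z r)
        linarith)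
  linarith

lemma median_nonneg {R : ℕ} {x : Fin R → ℝ} (hx : ∀ r, 0 ≤ x r) : 0 ≤ median x := by
  unfold median
  split_ifs
  · exact hx _
  · exact le_rfl

open Classical in
/-- If an event has probability at most `1/8`, it occurs in half of `2m+1` independent trials with
probability at most `2^(2m+1) 8^(-(m+1)) = 2^(-(m+2))`, by a union bound over the sets of `m+1`
trials. -/
lemma pi_minority_le {Ω : Type*} [MeasurableSpace Ω] (μ : Measure Ω) [IsProbabilityMeasure μ]
    {B : Set Ω} (hB : μ B ≤ 8⁻¹) (m : ℕ) :
    Measure.pi (fun _ : Fin (2 * m + 1) => μ)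
      {ω | ¬ 2 * m + 1 < 2 * (Finset.univ.filter fun r => ω r ∉ B).card} ≤ (2 ^ (m + 2))⁻¹ := by
  classical
  set P := Finset.powersetCard (m + 1) (Finset.univ : Finset (Fin (2 * m + 1))) with hP
  have hsub : {ω : Fin (2 * m + 1) → Ω |
      ¬ 2 * m + 1 < 2 * (Finset.univ.filter fun r => ω r ∉ B).card}
      ⊆ ⋃ S ∈ P, Set.univ.pi fun r => if r ∈ S then B else Set.univ := by
    intro ω hω
    simp only [Set.mem_ofPred_eq, not_lt] at hω
    have hc := Finset.card_filter_add_card_filter_not (s := (Finset.univ : Finset (Fin (2 * m + 1))))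
      (fun r => ω r ∉ B)
    rw [Finset.card_univ, Fintype.card_fin] at hc
    obtain ⟨S, hS, hScard⟩ := Finset.exists_subset_card_eq
      (show m + 1 ≤ (Finset.univ.filter fun r => ¬ ω r ∉ B).card by omega)
    simp only [Set.mem_iUnion]
    refine ⟨S, Finset.mem_powersetCard.2 ⟨Finset.subset_univ _, hScard⟩, fun r _ => ?_⟩
    by_cases hr : r ∈ S
    · simpa [hr] using hS hr
    · simp [hr]
  have hone : ∀ S ∈ P, Measure.pi (fun _ : Fin (2 * m + 1) => μ)
      (Set.univ.pi fun r => if r ∈ S then B else Set.univ) ≤ (8⁻¹ : ENNReal) ^ (m + 1) := by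
    intro S hS
    rw [Measure.pi_pi]
    have : ∀ r, μ (if r ∈ S then B else Set.univ) = if r ∈ S then μ B else 1 := fun r => by
      split_ifs <;> simp
    simp only [this]
    rw [Finset.prod_ite_mem, Finset.univ_inter, Finset.prod_const, (Finset.mem_powersetCard.1 hS).2]
    gcongr
  have hcard : P.card ≤ 2 ^ (2 * m + 1) := by
    rw [hP, Finset.card_powersetCard, Finset.card_univ, Fintype.card_fin]
    exact Nat.choose_le_two_pow _ _
  calc _ ≤ ∑ S ∈ P, Measure.pi (fun _ : Fin (2 * m + 1) => μ)
        (Set.univ.pi fun r => if r ∈ S then B else Set.univ) :=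
        (measure_mono hsub).trans (measure_biUnion_finset_le _ _)
    _ ≤ ∑ S ∈ P, (8⁻¹ : ENNReal) ^ (m + 1) := Finset.sum_le_sum hone
    _ ≤ 2 ^ (2 * m + 1) * (8⁻¹ : ENNReal) ^ (m + 1) := by
        rw [Finset.sum_const, nsmul_eq_mul]
        gcongr
        exact_mod_cast hcard
    _ = (2 ^ (m + 2))⁻¹ := by
        have : (8 : ENNReal) ^ (m + 1) = 2 ^ (2 * m + 1) * 2 ^ (m + 2) := by
          rw [← pow_add, show (8 : ENNReal) = 2 ^ 3 by norm_num, ← pow_mul]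
          congr 1; ring
        rw [← ENNReal.inv_pow, this, ENNReal.mul_inv (by simp) (by simp), ← mul_assoc,
          ENNReal.mul_inv_cancel (by simp) (by simp), one_mul]

/-! ### Hyperbolic crosses -/

lemma mem_hsupp {d : ℕ} {h : Fin d → ℤ} {j : Fin d} : j ∈ hsupp h ↔ h j ≠ 0 := by
  simp [hsupp]

lemma one_le_abs_of_mem_hsupp {d : ℕ} {h : Fin d → ℤ} {j : Fin d} (hj : j ∈ hsupp h) :
    1 ≤ |(h j : ℝ)| := by
  exact_mod_cast Int.one_le_abs (mem_hsupp.1 hj)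

lemma abs_le_prod_hsupp {d : ℕ} {h : Fin d → ℤ} {j : Fin d} (hj : j ∈ hsupp h) :
    |(h j : ℝ)| ≤ ∏ i ∈ hsupp h, |(h i : ℝ)| := by
  rw [← Finset.mul_prod_erase _ _ hj]
  refine le_mul_of_one_le_right (abs_nonneg _) ?_
  rw [← Finset.prod_const_one (s := (hsupp h).erase j)]
  exact Finset.prod_le_prod (fun _ _ => zero_le_one)
    fun i hi => one_le_abs_of_mem_hsupp (Finset.mem_of_mem_erase hi)

lemma abs_lt_of_mem_cross {d : ℕ} {L : ℝ} (hL : 0 < L) {h : Fin d → ℤ} (hh : h ∈ cross d L)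
    (j : Fin d) : |(h j : ℝ)| < L := by
  by_cases hj : h j = 0
  · simpa [hj] using hL
  · exact (abs_le_prod_hsupp (mem_hsupp.2 hj)).trans_lt hh

/-- Distinct elements of `A_d(N/2)` are incongruent modulo `N`. -/
lemma eq_of_congr_of_mem_cross {d N : ℕ} (hN : 0 < N) {g h : Fin d → ℤ}
    (hg : g ∈ cross d ((N : ℝ) / 2)) (hh : h ∈ cross d ((N : ℝ) / 2)) (hc : Congr N g h) :
    g = h := by
  have hN2 : (0 : ℝ) < (N : ℝ) / 2 := by positivity
  ext j
  have h1 := abs_lt_of_mem_cross hN2 hg j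
  have h2 := abs_lt_of_mem_cross hN2 hh j
  have h3 : |((g j - h j : ℤ) : ℝ)| < N := by
    push_cast
    exact (abs_sub _ _).trans_lt (by linarith)
  have := Int.eq_zero_of_abs_lt_dvd (hc j) (by exact_mod_cast h3)
  omega

lemma finite_setOf_forall_abs_lt (d : ℕ) (L : ℝ) :
    {h : Fin d → ℤ | ∀ j, |(h j : ℝ)| < L}.Finite := by
  refine (Set.finite_Icc (fun _ : Fin d => -⌈L⌉) fun _ => ⌈L⌉).subset fun h hh => ?_
  have : ∀ j, |h j| ≤ ⌈L⌉ := fun j => by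
    have := (hh j).le.trans (Int.le_ceil L)
    exact_mod_cast this
  exact ⟨fun j => (abs_le.1 (this j)).1, fun j => (abs_le.1 (this j)).2⟩

lemma finite_cross (d : ℕ) {L : ℝ} (hL : 0 < L) : (cross d L).Finite :=
  (finite_setOf_forall_abs_lt d L).subset fun _ hh j => abs_lt_of_mem_cross hL hh j

/-- The hyperbolic cross `A_d(N/2)` as a finite set. -/
noncomputable def halfCross (d N : ℕ) (hN : 0 < N) : Finset (Fin d → ℤ) :=
  (finite_cross d (show (0 : ℝ) < (N : ℝ) / 2 by positivity)).toFinset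

lemma mem_halfCross {d N : ℕ} {hN : 0 < N} {h : Fin d → ℤ} :
    h ∈ halfCross d N hN ↔ h ∈ cross d ((N : ℝ) / 2) := by
  simp [halfCross]

lemma le_card_halfCross {d N : ℕ} (hd : 1 ≤ d) (hN : 0 < N) (hN3 : 3 ≤ N) (hodd : Odd N) :
    N ≤ (halfCross d N hN).card := by
  obtain ⟨m, hm⟩ := hodd
  let i0 : Fin d := ⟨0, hd⟩
  have hinj : Set.InjOn (fun k : ℕ => (Pi.single i0 ((k : ℤ) - m) : Fin d → ℤ))
      (Finset.range N : Set ℕ) := by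
    intro a _ b _ hab
    have := Pi.single_injective i0 hab
    simpa using this
  have hle := Finset.card_le_card_of_injOn (t := halfCross d N hN) _ (fun k hk => ?_) hinj
  · simpa using hle
  · rw [Finset.mem_coe, mem_halfCross]
    have hk : k < N := by simpa using hk
    change ∏ j ∈ hsupp _, |((Pi.single i0 ((k : ℤ) - m) : Fin d → ℤ) j : ℝ)| < _
    have hN' : (N : ℝ) = 2 * m + 1 := by exact_mod_cast hm
    by_cases h0 : (k : ℤ) - m = 0
    · have : hsupp (Pi.single i0 ((k : ℤ) - m) : Fin d → ℤ) = ∅ := by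
        simp [h0, hsupp]
      have : (3 : ℝ) ≤ N := by exact_mod_cast hN3
      rw [‹hsupp _ = ∅›, Finset.prod_empty]
      linarith
    · have : hsupp (Pi.single i0 ((k : ℤ) - m) : Fin d → ℤ) = {i0} := by
        ext j
        rw [mem_hsupp, Finset.mem_singleton]
        by_cases hj : j = i0
        · subst hj; simpa using h0
        · simp [hj]
      rw [this, Finset.prod_singleton, Pi.single_eq_same]
      have : |(k : ℤ) - m| ≤ m := abs_le.2 (by omega)
      have : |(((k : ℤ) - m : ℤ) : ℝ)| ≤ m := by exact_mod_cast this
      linarith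

/-! ### From good draws to the error of the algorithm -/

lemma exists_top_subset {ι : Type*} [DecidableEq ι] (A : Finset ι) (b : ι → ℝ) (n : ℕ)
    (hn : n ≤ A.card) :
    ∃ K ⊆ A, K.card = n ∧ ∀ h ∈ K, ∀ h' ∈ A, h' ∉ K → b h' ≤ b h := by
  induction n with
  | zero => exact ⟨∅, by simp, by simp, by simp⟩
  | succ n ih =>
    obtain ⟨K, hK, hc, htop⟩ := ih (by omega)
    have hne : (A \ K).Nonempty := by
      rw [← Finset.card_pos, Finset.card_sdiff_of_subset hK]; omega
    obtain ⟨x, hx, hmax⟩ := Finset.exists_max_image (A \ K) b hne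
    rw [Finset.mem_sdiff] at hx
    refine ⟨insert x K, Finset.insert_subset hx.1 hK, by rw [Finset.card_insert_of_notMem hx.2, hc],
      fun h hh h' hh' hn' => ?_⟩
    rw [Finset.mem_insert, not_or] at hn'
    rcases Finset.mem_insert.1 hh with rfl | hh
    · exact hmax h' (Finset.mem_sdiff.2 ⟨hh', hn'.2⟩)
    · exact htop h hh h' hh' hn'.2

lemma sum_le_sum_of_card_le_of_forall_le {ι : Type*} {P Q : Finset ι} {b : ι → ℝ}
    (hb : ∀ i, 0 ≤ b i) (hc : P.card ≤ Q.card) (h : ∀ p ∈ P, ∀ q ∈ Q, b p ≤ b q) :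
    ∑ p ∈ P, b p ≤ ∑ q ∈ Q, b q := by
  rcases P.eq_empty_or_nonempty with rfl | hP
  · simpa using Finset.sum_nonneg fun q _ => hb q
  obtain ⟨x, hx, hmax⟩ := Finset.exists_max_image P b hP
  calc ∑ p ∈ P, b p ≤ P.card * b x := by
        rw [← nsmul_eq_mul]; exact Finset.sum_le_card_nsmul _ _ _ hmax
    _ ≤ Q.card * b x := by
        have := hb x
        gcongr
    _ ≤ ∑ q ∈ Q, b q := by
        rw [← nsmul_eq_mul]; exact Finset.card_nsmul_le_sum _ _ _ fun q hq => h x hx q hq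

lemma sum_le_energy {d : ℕ} {f : UnitAddTorus (Fin d) → ℂ} (hf : Continuous f)
    {P : Finset (Fin d → ℤ)} {S : Set (Fin d → ℤ)} (h : ∀ g ∈ P, g ∈ S) :
    ∑ g ∈ P, ‖mFourierCoeff f g‖ ^ 2 ≤ energy f S := by
  rw [← Finset.sum_congr rfl fun g hg =>
    Set.indicator_of_mem (h g hg) (fun g => ‖mFourierCoeff f g‖ ^ 2)]
  exact (summable_energy hf S).sum_le_tsum _
    fun g _ => Set.indicator_nonneg (fun _ _ => by positivity) g

/-- Each frequency outside `A_d(N/2)` is congruent to at most one frequency inside. -/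
lemma sum_energy_congr_le {d N : ℕ} (hN : 0 < N) {f : UnitAddTorus (Fin d) → ℂ}
    (hf : Continuous f) {U : Finset (Fin d → ℤ)} (hU : ∀ h ∈ U, h ∈ cross d ((N : ℝ) / 2)) :
    ∑ h ∈ U, energy f {g | g ≠ h ∧ Congr N g h} ≤ energy f (cross d ((N : ℝ) / 2))ᶜ := by
  unfold energy
  rw [← Summable.tsum_finsetSum fun h _ => summable_energy hf _]
  refine Summable.tsum_le_tsum (fun g => ?_) (summable_sum fun h _ => summable_energy hf _)
    (summable_energy hf _)
  by_cases hex : ∃ h ∈ U, g ≠ h ∧ Congr N g h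
  · obtain ⟨h, hh, hne, hc⟩ := hex
    have hg : g ∈ (cross d ((N : ℝ) / 2))ᶜ := fun hg =>
      hne (eq_of_congr_of_mem_cross hN hg (hU h hh) hc)
    rw [Finset.sum_eq_single h]
    · rw [Set.indicator_of_mem hg,
        Set.indicator_of_mem (show g ∈ {g | g ≠ h ∧ Congr N g h} from ⟨hne, hc⟩)]
    · intro h' hh' hne'
      refine Set.indicator_of_notMem (fun hm => hne' ?_) _
      refine eq_of_congr_of_mem_cross hN (hU h' hh') (hU h hh) fun j => ?_
      have := dvd_sub (hc j) (hm.2 j)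
      rwa [sub_sub_sub_cancel_left] at this
    · exact fun hn => absurd hh hn
  · push Not at hex
    rw [Finset.sum_eq_zero fun h hh => Set.indicator_of_notMem (fun hm => hex h hh hm.1 hm.2) _]
    exact Set.indicator_nonneg (fun _ _ => by positivity) _

/-- Parseval's identity for the error of the algorithm. -/
lemma sqError_eq {d R : ℕ} {f : UnitAddTorus (Fin d) → ℂ} (hf : Continuous f) (N : ℕ)
    (ω : Fin R → Draw d) (K : Finset (Fin d → ℤ)) :
    sqError f N ω K
      = ∑ h ∈ K, ‖cmedian (fun r => coeffEst f N (ω r) h) - mFourierCoeff f h‖ ^ 2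
        + energy f (K : Set (Fin d → ℤ))ᶜ := by
  have hA : Continuous (approx f N ω K) := by unfold approx; fun_prop
  have hP := hasSum_sq_mFourierCoeff_of_continuous (f := fun x => f x - approx f N ω K x)
    (hf.sub hA)
  have hcoef : ∀ h, mFourierCoeff (approx f N ω K) h
      = if h ∈ K then cmedian (fun r => coeffEst f N (ω r) h) else 0 := by
    intro h
    unfold approx
    rw [mFourierCoeff_finset_sum _ (fun k => by fun_prop)]
    simp only [mFourierCoeff_const_mul, mFourierCoeff_mFourier, mul_ite, mul_one, mul_zero,
      Finset.sum_ite_eq]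
  rw [sqError, ← hP.tsum_eq, ← hP.summable.sum_add_tsum_compl (s := K), energy,
    tsum_subtype (K : Set (Fin d → ℤ))ᶜ
      fun h => ‖mFourierCoeff (fun x => f x - approx f N ω K x) h‖ ^ 2]
  congr 1
  · refine Finset.sum_congr rfl fun h hh => ?_
    rw [mFourierCoeff_sub hf hA, hcoef, if_pos hh, norm_sub_rev]
  · refine tsum_congr fun h => ?_
    by_cases hh : h ∈ K
    · simp [hh]
    · rw [Set.indicator_of_mem (by simpa using hh), Set.indicator_of_mem (by simpa using hh),
        mFourierCoeff_sub hf hA, hcoef, if_neg hh, sub_zero]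

open Classical in
/-- The majority of the draws meets the error bound at `h`. -/
def GoodAt {d R : ℕ} (f : UnitAddTorus (Fin d) → ℂ) (N : ℕ) (G : Finset (Fin d → ℤ))
    (ω : Fin R → Draw d) (h : Fin d → ℤ) : Prop :=
  R < 2 * (Finset.univ.filter fun r => ω r ∉ badDraw f N G h).card

lemma GoodAt.majority {d R : ℕ} {f : UnitAddTorus (Fin d) → ℂ} {N : ℕ} {G : Finset (Fin d → ℤ)}
    {ω : Fin R → Draw d} {h : Fin d → ℤ} (hg : GoodAt f N G ω h) :
    R < 2 * (Finset.univ.filter fun r =>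
      ‖coeffEst f N (ω r) h - mFourierCoeff f h‖ ^ 2 ≤ errBound f N G h).card := by
  classical exact majority_mono hg fun r hr => not_lt.1 hr

/-- The frequencies of `G` that are not selected can be matched with selected frequencies outside `G`
whose medians are at least as large, so losing them costs no more than the energy outside `G`, up to
constants and median errors. -/
lemma sqError_le_of_goodAt {d R N : ℕ} (hN : 3 ≤ N)
    {f : UnitAddTorus (Fin d) → ℂ} (hf : Continuous f) {G : Finset (Fin d → ℤ)}
    (hG : 16 * G.card ≤ N - 1) {ω : Fin R → Draw d}
    (hgood : ∀ h ∈ cross d ((N : ℝ) / 2), GoodAt f N G ω h) {K : Finset (Fin d → ℤ)}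
    (hK : IsSelection f N ω K) :
    sqError f N ω K ≤ 200 * (energy f (G : Set (Fin d → ℤ))ᶜ + energy f (cross d ((N : ℝ) / 2))ᶜ) := by
  classical
  set a : (Fin d → ℤ) → ℝ := fun g => ‖mFourierCoeff f g‖ ^ 2 with ha
  set b : (Fin d → ℤ) → ℝ := medianSq f N ω with hb
  set e : (Fin d → ℤ) → ℝ := errBound f N G with he
  set tG := energy f (G : Set (Fin d → ℤ))ᶜ with htG
  set tA := energy f (cross d ((N : ℝ) / 2))ᶜ with htA
  have htG0 : 0 ≤ tG := energy_nonneg _ _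
  have htA0 : 0 ≤ tA := energy_nonneg _ _
  have he0 : ∀ h, 0 ≤ e h := errBound_nonneg f N G
  have hb0 : ∀ h, 0 ≤ b h := fun h => median_nonneg fun r => by positivity
  set P := (G.filter fun h => h ∈ cross d ((N : ℝ) / 2)) \ K with hP
  set Q := K \ G with hQ
  have hPmem : ∀ h, h ∈ P ↔ (h ∈ G ∧ h ∈ cross d ((N : ℝ) / 2)) ∧ h ∉ K := fun h => by
    simp [hP]
  have hQmem : ∀ h, h ∈ Q ↔ h ∈ K ∧ h ∉ G := fun h => by simp [hQ]
  have hdisj : Disjoint K P := Finset.disjoint_left.2 fun h hh hp => ((hPmem h).1 hp).2 hh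
  have hPG : P.card ≤ (G \ K).card := Finset.card_le_card fun h hh =>
    Finset.mem_sdiff.2 ⟨((hPmem h).1 hh).1.1, ((hPmem h).1 hh).2⟩
  have hPQ : P.card ≤ Q.card := by
    have h1 := Finset.card_sdiff_add_card_inter G K
    have h2 := Finset.card_sdiff_add_card_inter K G
    rw [Finset.inter_comm, hK.card] at h2
    rw [hQ]; omega
  -- the errors at the frequencies that matter
  have hesum : ∑ h ∈ K ∪ P, e h ≤ 16 * (tA + 2 * tG) := by
    have hU : ∀ h ∈ K ∪ P, h ∈ cross d ((N : ℝ) / 2) := fun h hh => by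
      rcases Finset.mem_union.1 hh with hh | hh
      · exact hK.subset h hh
      · exact ((hPmem h).1 hh).1.2
    have hcard : ((K ∪ P).card : ℝ) ≤ 2 * ((N - 1 : ℕ) : ℝ) := by
      have h1 := Finset.card_union_le K P
      have h2 : (G \ K).card ≤ G.card := Finset.card_le_card Finset.sdiff_subset
      rw [hK.card] at h1
      exact_mod_cast (by omega : (K ∪ P).card ≤ 2 * (N - 1))
    have hN1 : (0 : ℝ) < ((N - 1 : ℕ) : ℝ) := by exact_mod_cast (by omega : 0 < N - 1)
    simp only [he, errBound]
    rw [← Finset.mul_sum, Finset.sum_add_distrib, Finset.sum_const, nsmul_eq_mul]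
    have h1 := sum_energy_congr_le (by omega) hf hU
    have h2 : ((K ∪ P).card : ℝ) * (tG / ((N - 1 : ℕ) : ℝ)) ≤ 2 * tG := by
      rw [mul_div_assoc', div_le_iff₀ hN1]
      nlinarith
    linarith
  rw [Finset.sum_union hdisj] at hesum
  have hK1 : ∑ h ∈ K, ‖cmedian (fun r => coeffEst f N (ω r) h) - mFourierCoeff f h‖ ^ 2
      ≤ 2 * ∑ h ∈ K, e h := by
    rw [Finset.mul_sum]
    exact Finset.sum_le_sum fun h hh =>
      norm_cmedian_sub_sq_le (he0 h) (hgood h (hK.subset h hh)).majority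
  have hP1 : ∑ h ∈ P, a h ≤ 2 * ∑ h ∈ P, b h + 2 * ∑ h ∈ P, e h := by
    rw [Finset.mul_sum, Finset.mul_sum, ← Finset.sum_add_distrib]
    exact Finset.sum_le_sum fun h hh => norm_sq_le_median (hgood h ((hPmem h).1 hh).1.2).majority
  have hPQ1 : ∑ h ∈ P, b h ≤ ∑ h ∈ Q, b h :=
    sum_le_sum_of_card_le_of_forall_le hb0 hPQ fun p hp q hq =>
      hK.top q ((hQmem q).1 hq).1 p ((hPmem p).1 hp).1.2 ((hPmem p).1 hp).2
  have hQ1 : ∑ h ∈ Q, b h ≤ 2 * ∑ h ∈ Q, a h + 2 * ∑ h ∈ Q, e h := by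
    rw [Finset.mul_sum, Finset.mul_sum, ← Finset.sum_add_distrib]
    exact Finset.sum_le_sum fun h hh =>
      median_norm_sq_le (hgood h (hK.subset h ((hQmem h).1 hh).1)).majority
  have hQa : ∑ h ∈ Q, a h ≤ tG := sum_le_energy hf fun h hh => ((hQmem h).1 hh).2
  have hQe : ∑ h ∈ Q, e h ≤ ∑ h ∈ K, e h :=
    Finset.sum_le_sum_of_subset_of_nonneg Finset.sdiff_subset fun h _ _ => he0 h
  have hKc : energy f (K : Set (Fin d → ℤ))ᶜ ≤ tG + tA + ∑ h ∈ P, a h := by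
    have hfin : ∑ h ∈ P, a h = ∑' g, (P : Set (Fin d → ℤ)).indicator a g := by
      rw [← tsum_subtype, Finset.tsum_subtype' P a]
    have hsP := summable_energy hf (P : Set (Fin d → ℤ))
    have hsG := summable_energy hf (G : Set (Fin d → ℤ))ᶜ
    have hsA := summable_energy hf (cross d ((N : ℝ) / 2))ᶜ
    rw [hfin, htG, htA, energy, energy, energy, ← hsG.tsum_add hsA, ← (hsG.add hsA).tsum_add hsP]
    refine Summable.tsum_le_tsum (fun g => ?_) (summable_energy hf _) ((hsG.add hsA).add hsP)
    have h0 : ∀ S : Set (Fin d → ℤ), 0 ≤ S.indicator (fun g => ‖mFourierCoeff f g‖ ^ 2) g :=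
      fun S => Set.indicator_nonneg (fun _ _ => by positivity) _
    by_cases hgK : g ∈ K
    · rw [Set.indicator_of_notMem (by simpa using hgK)]
      exact add_nonneg (add_nonneg (h0 _) (h0 _)) (h0 _)
    rw [Set.indicator_of_mem (show g ∈ (K : Set (Fin d → ℤ))ᶜ by simpa using hgK)]
    by_cases hgG : g ∈ G
    · by_cases hgA : g ∈ cross d ((N : ℝ) / 2)
      · rw [Set.indicator_of_mem (show g ∈ (P : Set (Fin d → ℤ)) from
          (hPmem g).2 ⟨⟨hgG, hgA⟩, hgK⟩)]
        exact le_add_of_nonneg_left (add_nonneg (h0 _) (h0 _))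
      · rw [Set.indicator_of_mem (show g ∈ (cross d ((N : ℝ) / 2))ᶜ from hgA)]
        linarith [h0 (G : Set (Fin d → ℤ))ᶜ, h0 (P : Set (Fin d → ℤ))]
    · rw [Set.indicator_of_mem (show g ∈ (G : Set (Fin d → ℤ))ᶜ by simpa using hgG)]
      linarith [h0 (cross d ((N : ℝ) / 2))ᶜ, h0 (P : Set (Fin d → ℤ))]
  have hP0 : 0 ≤ ∑ h ∈ P, e h := Finset.sum_nonneg fun h _ => he0 h
  rw [sqError_eq hf]
  linarith

/-! ### Counting weighted hyperbolic crosses -/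

lemma hasSum_abs_int_rpow {q : ℝ} (hq : 1 < q) :
    HasSum (fun n : ℤ => |(n : ℝ)| ^ (-q)) (2 * zetaR q) := by
  have hs : Summable fun n : ℕ => 1 / ((n : ℝ) + 1) ^ q := by
    have := (Real.summable_one_div_nat_rpow.2 hq)
    have := (summable_nat_add_iff 1).2 this
    simpa using this
  have hterm : ∀ n : ℕ, |(n : ℝ) + 1| ^ (-q) = 1 / ((n : ℝ) + 1) ^ q := fun n => by
    have : (0 : ℝ) ≤ (n : ℝ) + 1 := by positivity
    rw [abs_of_nonneg this, Real.rpow_neg this, one_div]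
  have hpos : HasSum (fun n : ℕ => |((n : ℤ) : ℝ)| ^ (-q)) (zetaR q) := by
    rw [← hasSum_nat_add_iff' 1]
    have h0 : ∑ n ∈ Finset.range 1, |((n : ℤ) : ℝ)| ^ (-q) = 0 := by
      simp [Real.zero_rpow (by linarith : -q ≠ 0)]
    rw [h0, sub_zero]
    refine hs.hasSum.congr_fun fun n => ?_
    rw [← hterm]
    push_cast
    rfl
  have hneg : HasSum (fun n : ℕ => |((-((n : ℤ) + 1) : ℤ) : ℝ)| ^ (-q)) (zetaR q) := by
    refine hs.hasSum.congr_fun fun n => ?_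
    rw [← hterm]
    push_cast
    rw [abs_neg]
  rw [two_mul]
  exact HasSum.of_nat_of_neg_add_one hpos hneg

lemma one_le_zetaR {q : ℝ} (hq : 1 < q) : 1 ≤ zetaR q := by
  have h := sum_le_hasSum {1, -1} (fun n _ => by positivity) (hasSum_abs_int_rpow hq)
  norm_num at h
  linarith

lemma IsWeight.one_le_rKor {d : ℕ} {α : ℝ} (hα : 0 < α) {γ : Finset (Fin d) → ℝ} (hγ : IsWeight γ)
    (h : Fin d → ℤ) : 1 ≤ rKor α γ h := by
  rw [rKor, ← one_mul (1 : ℝ)]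
  refine mul_le_mul ((one_le_inv₀ (hγ.pos _)).2 (hγ.le_one _)) ?_ zero_le_one
    (inv_nonneg.2 (hγ.pos _).le)
  rw [← Finset.prod_const_one (s := hsupp h)]
  exact Finset.prod_le_prod (fun _ _ => zero_le_one)
    fun i hi => Real.one_le_rpow (one_le_abs_of_mem_hsupp hi) (by positivity)

lemma rKor_eq {d : ℕ} (α : ℝ) (γ : Finset (Fin d) → ℝ) (h : Fin d → ℤ) :
    rKor α γ h = (γ (hsupp h))⁻¹ * (∏ j ∈ hsupp h, |(h j : ℝ)|) ^ (2 * α) := by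
  rw [rKor, Real.finsetProd_rpow _ _ fun _ _ => abs_nonneg _]

/-- Summation over all frequencies with a given support gives a power of `2 ζ(q)`. -/
lemma sum_prod_hsupp_le {d : ℕ} {q : ℝ} (hq : 1 < q) (F : Finset (Fin d → ℤ)) (u : Finset (Fin d)) :
    ∑ h ∈ F with hsupp h = u, ∏ j ∈ u, |(h j : ℝ)| ^ (-q) ≤ (2 * zetaR q) ^ u.card := by
  classical
  let t : Fin d → Finset ℤ := fun j => if j ∈ u then F.image fun h => h j else {0}
  let a : Fin d → ℤ → ℝ := fun j n => if j ∈ u then |(n : ℝ)| ^ (-q) else 1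
  have ha : ∀ j n, 0 ≤ a j n := fun j n => by
    simp only [a]; split_ifs <;> positivity
  have hsub : (F.filter fun h => hsupp h = u) ⊆ Fintype.piFinset t := by
    intro h hh
    rw [Finset.mem_filter] at hh
    refine Fintype.mem_piFinset.2 fun j => ?_
    simp only [t]
    split_ifs with hj
    · exact Finset.mem_image_of_mem _ hh.1
    · rw [Finset.mem_singleton]
      by_contra hne
      exact hj (hh.2 ▸ mem_hsupp.2 hne)
  calc ∑ h ∈ F with hsupp h = u, ∏ j ∈ u, |(h j : ℝ)| ^ (-q)
      = ∑ h ∈ F with hsupp h = u, ∏ j, a j (h j) := by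
        refine Finset.sum_congr rfl fun h _ => ?_
        simp only [a]
        rw [Finset.prod_ite_mem, Finset.univ_inter]
    _ ≤ ∑ h ∈ Fintype.piFinset t, ∏ j, a j (h j) :=
        Finset.sum_le_sum_of_subset_of_nonneg hsub
          fun h _ _ => Finset.prod_nonneg fun j _ => ha j _
    _ = ∏ j, ∑ n ∈ t j, a j n := (Finset.prod_univ_sum t a).symm
    _ ≤ ∏ j, if j ∈ u then 2 * zetaR q else 1 := by
        refine Finset.prod_le_prod (fun j _ => Finset.sum_nonneg fun n _ => ha j n) fun j _ => ?_
        by_cases hj : j ∈ u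
        · simp only [a, if_pos hj]
          exact sum_le_hasSum _ (fun n _ => by positivity) (hasSum_abs_int_rpow hq)
        · simp [a, t, hj]
    _ = (2 * zetaR q) ^ u.card := by
        rw [Finset.prod_ite_mem, Finset.univ_inter, Finset.prod_const]

lemma sum_rKor_rpow_le {d : ℕ} {α lam : ℝ} {γ : Finset (Fin d) → ℝ} (hγ : IsWeight γ)
    (hq : 1 < 2 * α * lam) (F : Finset (Fin d → ℤ)) :
    ∑ h ∈ F, rKor α γ h ^ (-lam) ≤ Tsum α lam γ := by
  classical
  rw [← Finset.sum_fiberwise F hsupp, Tsum]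
  refine Finset.sum_le_sum fun u _ => ?_
  have : ∀ h ∈ F.filter fun h => hsupp h = u,
      rKor α γ h ^ (-lam) = γ u ^ lam * ∏ j ∈ u, |(h j : ℝ)| ^ (-(2 * α * lam)) := by
    intro h hh
    rw [← (Finset.mem_filter.1 hh).2, rKor_eq, Real.mul_rpow (inv_nonneg.2 (hγ.pos _).le)
      (by positivity), ← Real.rpow_mul (by positivity), Real.inv_rpow (hγ.pos _).le,
      Real.rpow_neg (hγ.pos _).le, inv_inv, Real.finsetProd_rpow _ _ fun _ _ => abs_nonneg _,
      mul_neg]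
  rw [Finset.sum_congr rfl this, ← Finset.mul_sum]
  exact mul_le_mul_of_nonneg_left (sum_prod_hsupp_le hq F u) (Real.rpow_nonneg (hγ.pos u).le _)

lemma finite_wcross {d : ℕ} {α : ℝ} (hα : 0 < α) {γ : Finset (Fin d) → ℝ} (hγ : IsWeight γ)
    {L : ℝ} (hL : 0 ≤ L) : (wcross α γ L).Finite := by
  rcases hL.eq_or_lt with rfl | hL
  · convert Set.finite_empty (α := Fin d → ℤ)
    ext h
    have := hγ.one_le_rKor hα h
    simp only [wcross, Set.mem_ofPred_eq, Set.mem_empty_iff_false, iff_false, not_lt]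
    rw [Real.zero_rpow (by positivity)]
    linarith
  refine (finite_cross d hL).subset fun h hh => ?_
  rw [wcross, Set.mem_ofPred_eq, rKor_eq] at hh
  refine (Real.rpow_lt_rpow_iff (by positivity) hL.le (by positivity : 0 < 2 * α)).1
    (lt_of_le_of_lt ?_ hh)
  exact le_mul_of_one_le_left (by positivity) ((one_le_inv₀ (hγ.pos _)).2 (hγ.le_one _))

lemma ncard_wcross_le {d : ℕ} {α lam : ℝ} {γ : Finset (Fin d) → ℝ} (hγ : IsWeight γ)
    (hα : 0 < α) (hlam : 0 < lam) (hq : 1 < 2 * α * lam) {L : ℝ} (hL : 0 < L) :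
    ((wcross α γ L).ncard : ℝ) ≤ L ^ (2 * α * lam) * Tsum α lam γ := by
  have hfin := finite_wcross hα hγ hL.le
  rw [Set.ncard_eq_toFinset_card _ hfin]
  calc (hfin.toFinset.card : ℝ) = ∑ h ∈ hfin.toFinset, (1 : ℝ) := by simp
    _ ≤ ∑ h ∈ hfin.toFinset, L ^ (2 * α * lam) * rKor α γ h ^ (-lam) := by
        refine Finset.sum_le_sum fun h hh => ?_
        have hr : 0 < rKor α γ h := zero_lt_one.trans_le (hγ.one_le_rKor hα h)
        have hlt : rKor α γ h < L ^ (2 * α) := by simpa [wcross] using hh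
        rw [Real.rpow_neg hr.le, Real.rpow_mul hL.le, ← div_eq_mul_inv,
          one_le_div (by positivity)]
        exact Real.rpow_le_rpow hr.le hlt.le hlam.le
    _ ≤ L ^ (2 * α * lam) * Tsum α lam γ := by
        rw [← Finset.mul_sum]
        exact mul_le_mul_of_nonneg_left (sum_rKor_rpow_le hγ hq _) (by positivity)

/-- `|A_d(N/2)| ≤ (N/2)² (1 + 2 ζ(2))^d`: the unweighted cross is a weighted one with `α = 1`. -/
lemma card_halfCross_le {d N : ℕ} (hN : 0 < N) :
    ((halfCross d N hN).card : ℝ) ≤ (N : ℝ) ^ 2 / 4 * (1 + 2 * zetaR 2) ^ d := by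
  have hγ : IsWeight (fun _ : Finset (Fin d) => (1 : ℝ)) :=
    ⟨fun _ => one_pos, fun _ => le_rfl, fun _ _ _ => le_rfl⟩
  have hN2 : (0 : ℝ) < (N : ℝ) / 2 := by positivity
  have hle := ncard_wcross_le hγ one_pos one_pos (by norm_num) hN2
  have hT : Tsum 1 1 (fun _ : Finset (Fin d) => (1 : ℝ)) = (1 + 2 * zetaR 2) ^ d := by
    have := Fintype.sum_pow_mul_eq_add_pow (Fin d) (2 * zetaR 2) 1
    simp only [one_pow, mul_one, Fintype.card_fin] at this
    rw [add_comm, ← this]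
    simp [Tsum]
  rw [hT] at hle
  have hcard : ((halfCross d N hN).card : ℝ)
      ≤ ((wcross 1 (fun _ : Finset (Fin d) => (1 : ℝ)) ((N : ℝ) / 2)).ncard : ℝ) := by
    rw [← Set.ncard_coe_finset]
    refine Nat.cast_le.2 (Set.ncard_le_ncard (fun h hh => ?_) (finite_wcross one_pos hγ hN2.le))
    have hh : ∏ j ∈ hsupp h, |(h j : ℝ)| < (N : ℝ) / 2 := mem_halfCross.1 hh
    rw [wcross, Set.mem_ofPred_eq, rKor_eq, inv_one, one_mul]
    exact Real.rpow_lt_rpow (by positivity) hh (by norm_num)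
  refine hcard.trans (hle.trans_eq ?_)
  have h2 : ((N : ℝ) / 2) ^ (2 * 1 * 1 : ℝ) = ((N : ℝ) / 2) ^ 2 := by
    rw [← Real.rpow_natCast]; norm_num
  rw [h2]
  ring

/-! ### The error bound holds with high probability -/

/-- The second term in the lower bound for `R` makes `|A_d(N/2)|` failures of probability `2^(-(m+2))`
each affordable. -/
lemma RLarge.card_halfCross_le {d N m : ℕ} {ε : ℝ} (hN : 0 < N) (hε : 0 < ε)
    (hR : RLarge d N (2 * m + 1) ε) :
    ((halfCross d N hN).card : ℝ) ≤ ε * 2 ^ (m + 2) := by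
  set M := 1 + 2 * zetaR 2 with hM
  have hM1 : 0 < M := by
    have := one_le_zetaR (q := 2) (by norm_num)
    linarith
  have hNpos : (0 : ℝ) < N := by exact_mod_cast hN
  have hl2 : 0 < Real.log 2 := Real.log_pos (by norm_num)
  have h1 : (Real.log (3 * (N : ℝ) ^ 2) - Real.log (4 * ε)) / Real.log 2
        + Real.log M / Real.log 2 * d ≤ (m + 2 : ℕ) := by
    have h2 := (mul_le_mul_of_nonneg_left (le_max_right _ _) (zero_le_two (α := ℝ))).trans hR
    push_cast at h2 ⊢
    linarith
  have h2 : Real.log (3 * (N : ℝ) ^ 2 / (4 * ε) * M ^ d) ≤ Real.log (2 ^ (m + 2)) := by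
    rw [Real.log_mul (by positivity) (by positivity), Real.log_div (by positivity) (by positivity),
      Real.log_pow, Real.log_pow]
    have h3 := mul_le_mul_of_nonneg_right h1 hl2.le
    rw [add_mul, div_mul_cancel₀ _ hl2.ne', mul_right_comm, div_mul_cancel₀ _ hl2.ne'] at h3
    linarith
  have h3 := (Real.log_le_log_iff (by positivity) (by positivity)).1 h2
  have h4 : (N : ℝ) ^ 2 / 4 * M ^ d ≤ ε * (3 * (N : ℝ) ^ 2 / (4 * ε) * M ^ d) := by
    have : ε * (3 * (N : ℝ) ^ 2 / (4 * ε) * M ^ d) = 3 * ((N : ℝ) ^ 2 / 4 * M ^ d) := by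
      field_simp
    rw [this]
    have : 0 ≤ (N : ℝ) ^ 2 / 4 * M ^ d := by positivity
    linarith
  exact (MedianLattice.card_halfCross_le hN).trans
    (h4.trans (mul_le_mul_of_nonneg_left h3 hε.le))

lemma HoldsWithProb.mono {Ω : Type*} [MeasurableSpace Ω] {μ : Measure Ω} {p : ℝ} {P Q : Ω → Prop}
    (h : HoldsWithProb μ p P) (hPQ : ∀ ω, P ω → Q ω) : HoldsWithProb μ p Q :=
  let ⟨E, hE, hp, hP⟩ := h
  ⟨E, hE, hp, fun ω hω => hPQ ω (hP ω hω)⟩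

lemma SqErrorLE.mono {d R : ℕ} {f : UnitAddTorus (Fin d) → ℂ} {N : ℕ} {ω : Fin R → Draw d}
    {B B' : ℝ} (h : SqErrorLE f N ω B) (hB : B ≤ B') : SqErrorLE f N ω B' :=
  ⟨h.1, fun K hK => (h.2 K hK).trans hB⟩

lemma measurableSet_goodAt {d R : ℕ} {f : UnitAddTorus (Fin d) → ℂ} (hf : Continuous f) (N : ℕ)
    (G : Finset (Fin d → ℤ)) (h : Fin d → ℤ) :
    MeasurableSet {ω : Fin R → Draw d | GoodAt f N G ω h} := by
  classical
  have : {ω : Fin R → Draw d | GoodAt f N G ω h}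
      = {ω | R < 2 * ∑ r, if ω r ∈ badDraw f N G h then 0 else 1} := by
    ext ω
    simp only [GoodAt, Set.mem_ofPred_eq, Finset.card_filter, ite_not]
  rw [this]
  refine measurableSet_lt measurable_const (measurable_const.mul
    (Finset.measurable_fun_sum _ fun r _ => ?_))
  exact Measurable.ite (measurable_pi_apply r (measurableSet_badDraw hf N G h)) measurable_const
    measurable_const

lemma three_le_of_prime_of_odd {N : ℕ} (hN : N.Prime) (hodd : Odd N) : 3 ≤ N := by
  obtain ⟨k, hk⟩ := hodd
  have := hN.two_le
  omega

/-- The error of the algorithm is bounded, up to a constant, by the energy outside any set `G` of at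
most `(N-1)/16` frequencies and the energy outside the search domain. -/
theorem holdsWithProb_sqErrorLE_energy {d N R : ℕ} (hd : 1 ≤ d) (hN : N.Prime) (hodd : Odd N)
    {f : UnitAddTorus (Fin d) → ℂ} (hf : Continuous f) {G : Finset (Fin d → ℤ)}
    (hG : 16 * G.card ≤ N - 1) {ε : ℝ} (hε : 0 < ε) (hR : Odd R) (hRl : RLarge d N R ε) :
    HoldsWithProb (law d N R) (1 - ε) fun ω => SqErrorLE f N ω
      (200 * (energy f (G : Set (Fin d → ℤ))ᶜ + energy f (cross d ((N : ℝ) / 2))ᶜ)) := by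
  classical
  obtain ⟨m, rfl⟩ := hR
  have hN3 := three_le_of_prime_of_odd hN hodd
  have hprob := isProbabilityMeasure_drawLaw d hN.two_le
  have hprob' : IsProbabilityMeasure (law d N (2 * m + 1)) := by
    unfold law; infer_instance
  set E : Set (Fin (2 * m + 1) → Draw d) :=
    ⋂ h ∈ halfCross d N hN.pos, {ω | GoodAt f N G ω h} with hE
  have hEm : MeasurableSet E :=
    Finset.measurableSet_biInter _ fun h _ => measurableSet_goodAt hf N G h
  have hEc : law d N (2 * m + 1) Eᶜ ≤ ENNReal.ofReal ε := by
    have hsub : Eᶜ ⊆ ⋃ h ∈ halfCross d N hN.pos, {ω | ¬ GoodAt f N G ω h} := by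
      intro ω hω
      simpa [hE] using hω
    calc law d N (2 * m + 1) Eᶜ
        ≤ ∑ h ∈ halfCross d N hN.pos, law d N (2 * m + 1) {ω | ¬ GoodAt f N G ω h} :=
          (measure_mono hsub).trans (measure_biUnion_finset_le _ _)
      _ ≤ ∑ h ∈ halfCross d N hN.pos, ((2 : ENNReal) ^ (m + 2))⁻¹ := by
          refine Finset.sum_le_sum fun h _ => ?_
          exact pi_minority_le (drawLaw d N) (drawLaw_badDraw_le hN hf hG h) m
      _ ≤ ENNReal.ofReal ε := by
          rw [Finset.sum_const, nsmul_eq_mul, ← div_eq_mul_inv,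
            ENNReal.div_le_iff (by simp) (by simp)]
          have h2 : (2 : ENNReal) ^ (m + 2) = ENNReal.ofReal (2 ^ (m + 2)) := by
            rw [ENNReal.ofReal_pow (by norm_num)]; simp
          rw [h2, ← ENNReal.ofReal_mul hε.le, ← ENNReal.ofReal_natCast]
          exact ENNReal.ofReal_le_ofReal (hRl.card_halfCross_le hN.pos hε)
  refine ⟨E, hEm, ?_, fun ω hω => ⟨?_, fun K hK => ?_⟩⟩
  · have h1 := prob_compl_eq_one_sub (μ := law d N (2 * m + 1)) hEm.compl
    rw [compl_compl] at h1
    rw [h1, ENNReal.ofReal_sub _ hε.le, ENNReal.ofReal_one]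
    exact tsub_le_tsub_left hEc 1
  · obtain ⟨K, hK, hc, htop⟩ := exists_top_subset (halfCross d N hN.pos) (medianSq f N ω) N
      (le_card_halfCross hd hN.pos hN3 hodd)
    exact ⟨K, ⟨fun h hh => mem_halfCross.1 (hK hh), hc,
      fun h hh h' hh' hn => htop h hh h' (mem_halfCross.2 hh') hn⟩⟩
  · exact sqError_le_of_goodAt hN3 hf hG
      (fun h hh => by simpa using Set.mem_iInter₂.1 hω h (mem_halfCross.2 hh)) hK

/-! ### The quantity `N_*` -/

lemma bddAbove_Nstar {d : ℕ} (hd : 1 ≤ d) {α : ℝ} (hα : 0 < α) {γ : Finset (Fin d) → ℝ}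
    (hγ : IsWeight γ) (N : ℕ) :
    BddAbove {L : ℝ | 0 ≤ L ∧ ((wcross α γ L).ncard : ℝ) ≤ ((N : ℝ) - 1) / 16} := by
  have : Nonempty (Fin d) := ⟨⟨0, hd⟩⟩
  obtain ⟨F, hF⟩ := Infinite.exists_subset_card_eq (Fin d → ℤ) (N + 1)
  have hr0 : ∀ h, 0 < rKor α γ h := fun h => zero_lt_one.trans_le (hγ.one_le_rKor hα h)
  set B := ∑ h ∈ F, rKor α γ h + 1 with hB
  have hB0 : 0 < B := add_pos_of_nonneg_of_pos (Finset.sum_nonneg fun h _ => (hr0 h).le) one_pos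
  refine ⟨B ^ (2 * α)⁻¹, fun L hL => ?_⟩
  by_contra! hlt
  have hBL : B ≤ L ^ (2 * α) := by
    have := Real.rpow_le_rpow (by positivity) hlt.le (by positivity : 0 ≤ 2 * α)
    rwa [Real.rpow_inv_rpow hB0.le (by positivity)] at this
  have hsub : (F : Set (Fin d → ℤ)) ⊆ wcross α γ L := fun h hh => by
    have := Finset.single_le_sum (f := rKor α γ) (fun h _ => (hr0 h).le) (Finset.mem_coe.1 hh)
    change rKor α γ h < _
    linarith
  have hc := Set.ncard_le_ncard hsub (finite_wcross hα hγ hL.1)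
  rw [Set.ncard_coe_finset, hF] at hc
  have hc' : (N : ℝ) + 1 ≤ (wcross α γ L).ncard := by exact_mod_cast hc
  have := hL.2
  have : (0 : ℝ) ≤ N := N.cast_nonneg
  linarith

lemma wcross_one {d : ℕ} {α : ℝ} (hα : 0 < α) {γ : Finset (Fin d) → ℝ} (hγ : IsWeight γ) :
    wcross α γ 1 = ∅ := by
  ext h
  simpa [wcross] using hγ.one_le_rKor hα h

lemma one_le_Nstar {d : ℕ} (hd : 1 ≤ d) {α : ℝ} (hα : 0 < α) {γ : Finset (Fin d) → ℝ}
    (hγ : IsWeight γ) {N : ℕ} (hN : 1 ≤ N) : 1 ≤ Nstar α γ N := by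
  refine le_csSup (bddAbove_Nstar hd hα hγ N) ⟨zero_le_one, ?_⟩
  have : (1 : ℝ) ≤ N := by exact_mod_cast hN
  rw [wcross_one hα hγ, Set.ncard_empty, Nat.cast_zero]
  linarith

/-- The supremum defining `N_*` is attained, since the crosses increase to the one at `N_*`. -/
lemma ncard_wcross_Nstar_le {d : ℕ} (hd : 1 ≤ d) {α : ℝ} (hα : 0 < α) {γ : Finset (Fin d) → ℝ}
    (hγ : IsWeight γ) {N : ℕ} (hN : 1 ≤ N) :
    ((wcross α γ (Nstar α γ N)).ncard : ℝ) ≤ ((N : ℝ) - 1) / 16 := by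
  have hN1 := one_le_Nstar hd hα hγ hN
  have hN' : (1 : ℝ) ≤ N := by exact_mod_cast hN
  have hfin := finite_wcross hα hγ (zero_le_one.trans hN1)
  rcases (wcross α γ (Nstar α γ N)).eq_empty_or_nonempty with h0 | hne
  · rw [h0, Set.ncard_empty, Nat.cast_zero]
    linarith
  obtain ⟨x, hx, hmax⟩ := Set.exists_max_image _ (rKor α γ) hfin hne
  have hr0 : 0 < rKor α γ x := zero_lt_one.trans_le (hγ.one_le_rKor hα x)
  have hlt : rKor α γ x ^ (2 * α)⁻¹ < Nstar α γ N := by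
    have := Real.rpow_lt_rpow hr0.le hx (by positivity : 0 < (2 * α)⁻¹)
    rwa [Real.rpow_rpow_inv (by linarith) (by positivity)] at this
  have hne0 : {L : ℝ | 0 ≤ L ∧ ((wcross α γ L).ncard : ℝ) ≤ ((N : ℝ) - 1) / 16}.Nonempty := by
    refine ⟨1, zero_le_one, ?_⟩
    rw [wcross_one hα hγ, Set.ncard_empty, Nat.cast_zero]
    linarith
  obtain ⟨L, hL, hxL⟩ := exists_lt_of_lt_csSup hne0 hlt
  refine le_trans (Nat.cast_le.2 (Set.ncard_le_ncard (fun h hh => ?_)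
    (finite_wcross hα hγ hL.1))) hL.2
  have := Real.rpow_lt_rpow (by positivity) hxL (by positivity : 0 < 2 * α)
  rw [Real.rpow_inv_rpow hr0.le (by positivity)] at this
  exact (hmax h hh).trans_lt this

lemma lt_ncard_wcross_of_Nstar_lt {d : ℕ} (hd : 1 ≤ d) {α : ℝ} (hα : 0 < α)
    {γ : Finset (Fin d) → ℝ} (hγ : IsWeight γ) {N : ℕ} (hN : 1 ≤ N) {L : ℝ}
    (hL : Nstar α γ N < L) : ((N : ℝ) - 1) / 16 < (wcross α γ L).ncard := by
  by_contra! hle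
  exact notMem_of_csSup_lt hL (bddAbove_Nstar hd hα hγ N)
    ⟨by linarith [one_le_Nstar hd hα hγ hN], hle⟩

lemma rpow_weight_le_Tsum_term {d : ℕ} {α lam : ℝ} {γ : Finset (Fin d) → ℝ} (hγ : IsWeight γ)
    (hq : 1 < 2 * α * lam) (u : Finset (Fin d)) :
    γ u ^ lam ≤ γ u ^ lam * (2 * zetaR (2 * α * lam)) ^ u.card := by
  have := one_le_zetaR hq
  exact le_mul_of_one_le_right (Real.rpow_nonneg (hγ.pos u).le _) (one_le_pow₀ (by linarith))

lemma rpow_weight_le_Tsum {d : ℕ} {α lam : ℝ} {γ : Finset (Fin d) → ℝ} (hγ : IsWeight γ)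
    (hq : 1 < 2 * α * lam) (u : Finset (Fin d)) : γ u ^ lam ≤ Tsum α lam γ :=
  (rpow_weight_le_Tsum_term hγ hq u).trans (Finset.single_le_sum
    (f := fun u => γ u ^ lam * (2 * zetaR (2 * α * lam)) ^ u.card)
    (fun v _ => (Real.rpow_nonneg (hγ.pos v).le _).trans (rpow_weight_le_Tsum_term hγ hq v))
    (Finset.mem_univ u))

lemma Tsum_pos {d : ℕ} {α lam : ℝ} {γ : Finset (Fin d) → ℝ} (hγ : IsWeight γ)
    (hq : 1 < 2 * α * lam) : 0 < Tsum α lam γ :=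
  (Real.rpow_pos_of_pos (hγ.pos ∅) _).trans_le (rpow_weight_le_Tsum hγ hq ∅)

lemma weight_le_Tsum_rpow {d : ℕ} {α lam : ℝ} {γ : Finset (Fin d) → ℝ} (hγ : IsWeight γ)
    (hlam : 0 < lam) (hq : 1 < 2 * α * lam) (u : Finset (Fin d)) :
    γ u ≤ Tsum α lam γ ^ (1 / lam) := by
  rw [one_div]
  have := Real.rpow_le_rpow (Real.rpow_nonneg (hγ.pos u).le _) (rpow_weight_le_Tsum hγ hq u)
    (by positivity : 0 ≤ lam⁻¹)
  rwa [Real.rpow_rpow_inv (hγ.pos u).le hlam.ne'] at this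

/-- The cross at any `L > N_*` has more than `(N-1)/16 ≥ N/24` elements; let `L` tend to `N_*`. -/
lemma le_mul_Nstar_rpow {d : ℕ} (hd : 1 ≤ d) {α lam : ℝ} (hα : 0 < α) {γ : Finset (Fin d) → ℝ}
    (hγ : IsWeight γ) (hlam : 0 < lam) (hq : 1 < 2 * α * lam) {N : ℕ} (hN : 3 ≤ N) :
    (N : ℝ) ≤ 24 * (Nstar α γ N ^ (2 * α * lam) * Tsum α lam γ) := by
  have hN1 := one_le_Nstar hd hα hγ (N := N) (by omega)
  have hlim : Filter.Tendsto (fun L : ℝ => L ^ (2 * α * lam) * Tsum α lam γ)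
      (nhdsWithin (Nstar α γ N) (Set.Ioi (Nstar α γ N)))
      (nhds (Nstar α γ N ^ (2 * α * lam) * Tsum α lam γ)) :=
    ((Real.continuousAt_rpow_const _ _ (Or.inr (by positivity))).mul
      continuousAt_const).tendsto.mono_left nhdsWithin_le_nhds
  have hle : ((N : ℝ) - 1) / 16 ≤ Nstar α γ N ^ (2 * α * lam) * Tsum α lam γ := by
    refine ge_of_tendsto hlim ?_
    filter_upwards [self_mem_nhdsWithin] with L hL
    exact (lt_ncard_wcross_of_Nstar_lt hd hα hγ (by omega) hL).le.trans
      (ncard_wcross_le hγ hα hlam hq (by linarith [Set.mem_Ioi.1 hL]))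
  have : (3 : ℝ) ≤ N := by exact_mod_cast hN
  linarith

/-- `N_*^{-2α} ≤ (24 T / N)^{1/λ}`. -/
lemma inv_Nstar_rpow_le {d : ℕ} (hd : 1 ≤ d) {α lam : ℝ} (hα : 0 < α) {γ : Finset (Fin d) → ℝ}
    (hγ : IsWeight γ) (hlam : 0 < lam) (hq : 1 < 2 * α * lam) {N : ℕ} (hN : 3 ≤ N) :
    1 / Nstar α γ N ^ (2 * α) ≤ 24 ^ (1 / lam) * (Tsum α lam γ / N) ^ (1 / lam) := by
  have hN1 := one_le_Nstar hd hα hγ (N := N) (by omega)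
  have hN0 : 0 < Nstar α γ N := by linarith
  have hNp : (0 : ℝ) < N := by positivity
  have hT := Tsum_pos hγ hq
  have h1 := le_mul_Nstar_rpow hd hα hγ hlam hq hN
  rw [← Real.mul_rpow (by norm_num) (by positivity)]
  have h2 : (1 / Nstar α γ N ^ (2 * α)) ^ lam ≤ 24 * (Tsum α lam γ / N) := by
    rw [Real.div_rpow zero_le_one (by positivity), Real.one_rpow, ← Real.rpow_mul hN0.le,
      div_le_iff₀ (by positivity)]
    rw [← mul_div_assoc, div_mul_eq_mul_div, le_div_iff₀ hNp]
    linarith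
  have h3 := Real.rpow_le_rpow (by positivity) h2 (by positivity : 0 ≤ 1 / lam)
  rwa [one_div lam, Real.rpow_rpow_inv (by positivity) hlam.ne', ← one_div lam] at h3

/-! ### Energies and the Korobov norm -/

lemma normSqKor_nonneg {d : ℕ} {α : ℝ} (hα : 0 < α) {γ : Finset (Fin d) → ℝ} (hγ : IsWeight γ)
    (f : UnitAddTorus (Fin d) → ℂ) : 0 ≤ normSqKor α γ f :=
  tsum_nonneg fun h => mul_nonneg (by positivity) (zero_le_one.trans (hγ.one_le_rKor hα h))

lemma energy_le_mul_normSqKor {d : ℕ} {α : ℝ} (hα : 0 < α) {γ : Finset (Fin d) → ℝ}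
    (hγ : IsWeight γ) {f : UnitAddTorus (Fin d) → ℂ} (hf : MemKorobov α γ f)
    {S : Set (Fin d → ℤ)} {τ : ℝ} (hτ : 0 ≤ τ) (h : ∀ g ∈ S, 1 ≤ τ * rKor α γ g) :
    energy f S ≤ normSqKor α γ f * τ := by
  rw [normSqKor, mul_comm, ← tsum_mul_left]
  refine (summable_energy hf.continuous S).tsum_le_tsum (fun g => ?_) (hf.summable.mul_left τ)
  have hr : 0 < rKor α γ g := zero_lt_one.trans_le (hγ.one_le_rKor hα g)
  by_cases hg : g ∈ S
  · rw [Set.indicator_of_mem hg, mul_left_comm]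
    exact le_mul_of_one_le_right (by positivity) (h g hg)
  · rw [Set.indicator_of_notMem hg]
    positivity

/-- A frequency outside `A_d(N/2)` has nonempty support, so that its Korobov weight involves only
`γ_u` with `u ≠ ∅`. -/
lemma energy_compl_cross_le {d : ℕ} {α : ℝ} (hα : 0 < α) {γ : Finset (Fin d) → ℝ}
    (hγ : IsWeight γ) {f : UnitAddTorus (Fin d) → ℂ} (hf : MemKorobov α γ f) {N : ℕ} (hN : 3 ≤ N)
    {M : ℝ} (hM : ∀ u, u.Nonempty → γ u ≤ M) (hM0 : 0 ≤ M) :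
    energy f (cross d ((N : ℝ) / 2))ᶜ
      ≤ normSqKor α γ f * (2 ^ (2 * α) * M / (N : ℝ) ^ (2 * α)) := by
  have hN3 : (3 : ℝ) ≤ N := by exact_mod_cast hN
  refine energy_le_mul_normSqKor hα hγ hf (by positivity) fun g hg => ?_
  have hge : (N : ℝ) / 2 ≤ ∏ j ∈ hsupp g, |(g j : ℝ)| := not_lt.1 hg
  have hne : (hsupp g).Nonempty := by
    by_contra hne
    rw [Finset.not_nonempty_iff_eq_empty.1 hne, Finset.prod_empty] at hge
    linarith
  have h1 := Real.rpow_le_rpow (by positivity) hge (by positivity : 0 ≤ 2 * α)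
  rw [Real.div_rpow (by positivity) (by norm_num)] at h1
  have h2 : 1 ≤ M * (γ (hsupp g))⁻¹ := by
    rw [← div_eq_mul_inv, one_le_div (hγ.pos _)]
    exact hM _ hne
  have h3 : 1 ≤ 2 ^ (2 * α) / (N : ℝ) ^ (2 * α) * (∏ j ∈ hsupp g, |(g j : ℝ)|) ^ (2 * α) := by
    calc (1 : ℝ) = 2 ^ (2 * α) / (N : ℝ) ^ (2 * α) * ((N : ℝ) ^ (2 * α) / 2 ^ (2 * α)) := by
          field_simp
      _ ≤ _ := by gcongr
  rw [rKor_eq]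
  calc (1 : ℝ) ≤ (M * (γ (hsupp g))⁻¹) *
        (2 ^ (2 * α) / (N : ℝ) ^ (2 * α) * (∏ j ∈ hsupp g, |(g j : ℝ)|) ^ (2 * α)) :=
        one_le_mul_of_one_le_of_one_le h2 h3
    _ = _ := by ring

/-- The error bound in terms of `N_*` and any bound `M` for the weights of nonempty sets. -/
theorem holdsWithProb_sqErrorLE_Nstar {d N R : ℕ} (hd : 1 ≤ d) {α : ℝ} (hα : 0 < α)
    {γ : Finset (Fin d) → ℝ} (hγ : IsWeight γ) (hN : N.Prime) (hodd : Odd N)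
    {f : UnitAddTorus (Fin d) → ℂ} (hf : MemKorobov α γ f) {ε : ℝ} (hε : 0 < ε) (hR : Odd R)
    (hRl : RLarge d N R ε) :
    HoldsWithProb (law d N R) (1 - ε) fun ω => ∀ M : ℝ, (∀ u, u.Nonempty → γ u ≤ M) → 0 ≤ M →
      SqErrorLE f N ω (normSqKor α γ f *
        (200 * (1 / Nstar α γ N ^ (2 * α) + 2 ^ (2 * α) * M / (N : ℝ) ^ (2 * α)))) := by
  have hN3 := three_le_of_prime_of_odd hN hodd
  have hN1 := one_le_Nstar hd hα hγ (N := N) (by omega)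
  have hN0 : 0 < Nstar α γ N := by linarith
  have hfin := finite_wcross hα hγ hN0.le
  have hG : 16 * hfin.toFinset.card ≤ N - 1 := by
    have h1 := ncard_wcross_Nstar_le hd hα hγ (N := N) (by omega)
    rw [Set.ncard_eq_toFinset_card _ hfin] at h1
    have h2 : (16 * hfin.toFinset.card + 1 : ℝ) ≤ N := by linarith
    have h3 : 16 * hfin.toFinset.card + 1 ≤ N := by exact_mod_cast h2
    omega
  have hGe : energy f (hfin.toFinset : Set (Fin d → ℤ))ᶜ
      ≤ normSqKor α γ f * (1 / Nstar α γ N ^ (2 * α)) := by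
    refine energy_le_mul_normSqKor hα hγ hf (by positivity) fun g hg => ?_
    have : Nstar α γ N ^ (2 * α) ≤ rKor α γ g := by simpa [wcross] using hg
    rw [div_mul_eq_mul_div, one_mul, one_le_div (by positivity)]
    exact this
  refine (holdsWithProb_sqErrorLE_energy hd hN hodd hf.continuous hG hε hR hRl).mono
    fun ω hω M hM hM0 => hω.mono ?_
  have := energy_compl_cross_le hα hγ hf hN3 hM hM0
  linarith

lemma pos_and_one_lt_of_inv_lt {α lam : ℝ} (hα : 0 < α) (hlam : 1 / (2 * α) < lam) :
    0 < lam ∧ 1 < 2 * α * lam := by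
  have h0 : 0 < 1 / (2 * α) := by positivity
  refine ⟨h0.trans hlam, ?_⟩
  rw [div_lt_iff₀ (by positivity)] at hlam
  linarith

lemma inv_rpow_two_alpha_le {α lam : ℝ} (hlam : 0 < lam) (hq : 1 < 2 * α * lam) {N : ℕ}
    (hN : 1 ≤ N) : 1 / (N : ℝ) ^ (2 * α) ≤ 1 / (N : ℝ) ^ (1 / lam) := by
  have : (1 : ℝ) ≤ N := by exact_mod_cast hN
  refine one_div_le_one_div_of_le (by positivity) (Real.rpow_le_rpow_of_exponent_le this ?_)
  rw [div_le_iff₀ hlam]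
  exact hq.le

/-- The right-hand side of the error bound decays at the rate `(T/N)^{1/λ}`. -/
lemma error_rate_le {d : ℕ} (hd : 1 ≤ d) {α lam : ℝ} (hα : 0 < α) {γ : Finset (Fin d) → ℝ}
    (hγ : IsWeight γ) (hlam : 0 < lam) (hq : 1 < 2 * α * lam) {N : ℕ} (hN : 3 ≤ N) :
    1 / Nstar α γ N ^ (2 * α) + 2 ^ (2 * α) * Tsum α lam γ ^ (1 / lam) / (N : ℝ) ^ (2 * α)
      ≤ (24 ^ (1 / lam) + 2 ^ (2 * α)) * (Tsum α lam γ / N) ^ (1 / lam) := by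
  have h1 := inv_Nstar_rpow_le hd hα hγ hlam hq hN
  have h2 := inv_rpow_two_alpha_le hlam hq (N := N) (by omega)
  have hT := Tsum_pos hγ hq
  have h3 : 2 ^ (2 * α) * Tsum α lam γ ^ (1 / lam) / (N : ℝ) ^ (2 * α)
      ≤ 2 ^ (2 * α) * (Tsum α lam γ / N) ^ (1 / lam) := by
    rw [Real.div_rpow hT.le (by positivity), div_eq_mul_one_div _ ((N : ℝ) ^ (2 * α)),
      mul_assoc, div_eq_mul_one_div _ ((N : ℝ) ^ (1 / lam))]
    gcongr
  linarith

theorem holdsWithProb_sqErrorLE_rate {d N R : ℕ} (hd : 1 ≤ d) {α : ℝ} (hα : 0 < α)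
    {γ : Finset (Fin d) → ℝ} (hγ : IsWeight γ) (hN : N.Prime) (hodd : Odd N)
    {f : UnitAddTorus (Fin d) → ℂ} (hf : MemKorobov α γ f) {ε : ℝ} (hε : 0 < ε) (hR : Odd R)
    (hRl : RLarge d N R ε) {lam : ℝ} (hlam : 1 / (2 * α) < lam) :
    HoldsWithProb (law d N R) (1 - ε) fun ω => SqErrorLE f N ω (normSqKor α γ f *
      (200 * ((24 ^ (1 / lam) + 2 ^ (2 * α)) * (Tsum α lam γ / N) ^ (1 / lam)))) := by
  obtain ⟨hl, hq⟩ := pos_and_one_lt_of_inv_lt hα hlam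
  have hN3 := three_le_of_prime_of_odd hN hodd
  refine (holdsWithProb_sqErrorLE_Nstar hd hα hγ hN hodd hf hε hR hRl).mono fun ω hω =>
    (hω _ (fun u _ => weight_le_Tsum_rpow hγ hl hq u)
      (Real.rpow_nonneg (Tsum_pos hγ hq).le _)).mono ?_
  have := error_rate_le hd hα hγ hl hq hN3
  have := normSqKor_nonneg hα hγ f
  gcongr

/-! ### Comparison of the two bounds -/

lemma sqTerm_nonneg {d : ℕ} {α : ℝ} (hα : 1 / 2 < α) (γ : Finset (Fin d) → ℝ)
    (u : Finset (Fin d)) : 0 ≤ sqTerm α γ u := by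
  have := one_le_zetaR (q := 4 * α) (by linarith)
  unfold sqTerm; positivity

lemma sqSum_nonneg {d : ℕ} {α : ℝ} (hα : 1 / 2 < α) (γ : Finset (Fin d) → ℝ) : 0 ≤ sqSum α γ :=
  Finset.sum_nonneg fun u _ => sqTerm_nonneg hα γ u

lemma weight_le_sqrt_sqSum {d : ℕ} {α : ℝ} (hα : 1 / 2 < α) {γ : Finset (Fin d) → ℝ}
    {u : Finset (Fin d)} (hu : u.Nonempty) :
    γ u ≤ √(sqSum α γ) / 2 ^ (2 * α) := by
  have hz := one_le_zetaR (q := 4 * α) (by linarith)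
  rw [le_div_iff₀ (by positivity)]
  refine Real.le_sqrt_of_sq_le ?_
  have h1 : sqTerm α γ u ≤ sqSum α γ := Finset.single_le_sum (f := sqTerm α γ)
    (fun v _ => sqTerm_nonneg hα γ v) (Finset.mem_erase.2 ⟨hu.ne_empty, Finset.mem_univ u⟩)
  refine le_trans ?_ h1
  have h2 : ((2 : ℝ) ^ (2 * α)) ^ 2 = 2 ^ (4 * α) := by
    rw [← Real.rpow_natCast, ← Real.rpow_mul (by norm_num)]
    congr 1; push_cast; ring
  have h3 : (2 : ℝ) ^ (4 * α) ≤ (2 : ℝ) ^ (1 + 4 * α) * zetaR (4 * α) := by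
    have : (2 : ℝ) ^ (4 * α) ≤ (2 : ℝ) ^ (1 + 4 * α) :=
      Real.rpow_le_rpow_of_exponent_le (by norm_num) (by linarith)
    exact this.trans (le_mul_of_one_le_right (by positivity) hz)
  have h4 : (1 : ℝ) ≤ 2 ^ (4 * α) := Real.one_le_rpow (by norm_num) (by linarith)
  rw [mul_pow, h2, sqTerm]
  refine mul_le_mul_of_nonneg_left (h3.trans ?_) (by positivity)
  exact le_self_pow₀ (h4.trans h3) hu.card_pos.ne'

lemma integral_wcross_nonneg {d : ℕ} {α : ℝ} (γ : Finset (Fin d) → ℝ) {c : ℝ} (hc : 0 ≤ c) :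
    0 ≤ ∫ L in Set.Ioi c, ((wcross α γ L).ncard : ℝ) / L ^ (4 * α + 1) :=
  setIntegral_nonneg measurableSet_Ioi fun L hL => by
    have : 0 < L := hc.trans_lt hL
    positivity

lemma integral_wcross_le {d : ℕ} {α lam : ℝ} {γ : Finset (Fin d) → ℝ} (hγ : IsWeight γ)
    (hα : 0 < α) (hlam : 0 < lam) (hlam2 : lam < 2) (hq : 1 < 2 * α * lam) {c : ℝ} (hc : 0 < c) :
    ∫ L in Set.Ioi c, ((wcross α γ L).ncard : ℝ) / L ^ (4 * α + 1)
      ≤ Tsum α lam γ * ((1 / c ^ (2 * α)) ^ (2 - lam) / (2 * α * (2 - lam))) := by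
  have ha : 2 * α * lam - 4 * α - 1 < -1 := by nlinarith
  have hint := integral_Ioi_rpow_of_lt ha hc
  have hI := (integrableOn_Ioi_rpow_of_lt ha hc).const_mul (Tsum α lam γ)
  have hval : -c ^ (2 * α * lam - 4 * α - 1 + 1) / (2 * α * lam - 4 * α - 1 + 1)
      = (1 / c ^ (2 * α)) ^ (2 - lam) / (2 * α * (2 - lam)) := by
    rw [one_div, ← Real.rpow_neg hc.le, ← Real.rpow_mul hc.le,
      show 2 * α * lam - 4 * α - 1 + 1 = -(2 * α * (2 - lam)) by ring, neg_div_neg_eq, neg_mul]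
  rw [← hval, ← hint, ← integral_const_mul]
  refine integral_mono_of_nonneg ?_ hI ?_
  · filter_upwards [ae_restrict_mem measurableSet_Ioi] with L hL
    have : 0 < L := hc.trans hL
    simp only [Pi.zero_apply]
    positivity
  · filter_upwards [ae_restrict_mem measurableSet_Ioi] with L hL
    have hL0 : 0 < L := hc.trans hL
    have h1 := ncard_wcross_le hγ hα hlam hq hL0
    rw [div_le_iff₀ (by positivity), mul_assoc, ← Real.rpow_add hL0,
      show 2 * α * lam - 4 * α - 1 + (4 * α + 1) = 2 * α * lam by ring]
    linarith

/-- The integral in `r̄_sum` is at most a multiple of `(T/N)^{2/λ}`, and `Σ_α / N^{4α}` at most a multiple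
of `(T/N)^{2/λ} Σ_α`. The latter requires either `N_* < N/2`, to compare with `N_*^{-2α}`, or `T ≥ 1`. -/
lemma sqrt_rSumBar_le {d : ℕ} (hd : 1 ≤ d) {α lam : ℝ} (hα : 1 / 2 < α) {γ : Finset (Fin d) → ℝ}
    (hγ : IsWeight γ) (hlam : 0 < lam) (hlam2 : lam < 2) (hq : 1 < 2 * α * lam) {N : ℕ}
    (hN : 3 ≤ N) (hcase : Nstar α γ N < (N : ℝ) / 2 ∨ γ ∅ = 1) :
    √(rSumBar α γ N) ≤ (Tsum α lam γ / N) ^ (1 / lam) *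
      (√(48 / (2 - lam) * 24 ^ ((2 - lam) / lam)) + 4 * (24 ^ (1 / lam) + 1) * √(sqSum α γ)) := by
  have hα0 : 0 < α := by linarith
  have hN1 := one_le_Nstar hd hα0 hγ (N := N) (by omega)
  have hN0 : 0 < Nstar α γ N := by linarith
  have hN3 : (3 : ℝ) ≤ N := by exact_mod_cast hN
  have hNp : (0 : ℝ) < N := by linarith
  have hT := Tsum_pos hγ hq
  have hS := sqSum_nonneg hα γ
  have hl2 : 0 < 2 - lam := by linarith
  set t := (Tsum α lam γ / N) ^ (1 / lam) with ht
  have ht0 : 0 < t := by positivity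
  have hNs : 1 / Nstar α γ N ^ (2 * α) ≤ 24 ^ (1 / lam) * t := inv_Nstar_rpow_le hd hα0 hγ hlam hq hN
  have hfirst : 16 * (4 * α / ((N : ℝ) - 1) *
      (∫ L in Set.Ioi (Nstar α γ N), ((wcross α γ L).ncard : ℝ) / L ^ (4 * α + 1)))
      ≤ t ^ 2 * (48 / (2 - lam) * 24 ^ ((2 - lam) / lam)) := by
    have h1 := integral_wcross_le hγ hα0 hlam hlam2 hq hN0
    have h2 : (1 / Nstar α γ N ^ (2 * α)) ^ (2 - lam) ≤ (24 ^ (1 / lam) * t) ^ (2 - lam) :=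
      Real.rpow_le_rpow (by positivity) hNs hl2.le
    have h3 : ((24 : ℝ) ^ (1 / lam) * t) ^ (2 - lam) = 24 ^ ((2 - lam) / lam) * t ^ (2 - lam) := by
      rw [Real.mul_rpow (by positivity) ht0.le, ← Real.rpow_mul (by norm_num)]
      congr 2; ring
    have h4 : t ^ lam = Tsum α lam γ / N := by
      rw [ht, one_div, Real.rpow_inv_rpow (by positivity) hlam.ne']
    have h5 : t ^ lam * t ^ (2 - lam) = t ^ 2 := by
      rw [← Real.rpow_add ht0, ← Real.rpow_natCast]
      congr 1; push_cast; ring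
    have h6 : 1 / ((N : ℝ) - 1) ≤ 3 / 2 * (1 / N) := by
      rw [div_mul_div_comm, div_le_div_iff₀ (by linarith) (by linarith)]
      linarith
    calc 16 * (4 * α / ((N : ℝ) - 1) *
          (∫ L in Set.Ioi (Nstar α γ N), ((wcross α γ L).ncard : ℝ) / L ^ (4 * α + 1)))
        ≤ 16 * (4 * α / ((N : ℝ) - 1) * (Tsum α lam γ *
            ((24 ^ ((2 - lam) / lam) * t ^ (2 - lam)) / (2 * α * (2 - lam))))) := by
          have : 0 ≤ 4 * α / ((N : ℝ) - 1) := div_nonneg (by linarith) (by linarith)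
          rw [h3] at h2
          refine mul_le_mul_of_nonneg_left (mul_le_mul_of_nonneg_left (h1.trans ?_) this)
            (by norm_num)
          gcongr
      _ = 1 / ((N : ℝ) - 1) * (32 / (2 - lam) * 24 ^ ((2 - lam) / lam) *
            (Tsum α lam γ * t ^ (2 - lam))) := by
          field_simp
          ring
      _ ≤ 3 / 2 * (1 / N) * (32 / (2 - lam) * 24 ^ ((2 - lam) / lam) *
            (Tsum α lam γ * t ^ (2 - lam))) := by gcongr
      _ = (Tsum α lam γ / N) * t ^ (2 - lam) * (48 / (2 - lam) * 24 ^ ((2 - lam) / lam)) := by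
          ring
      _ = _ := by rw [← h4, h5]
  have hNα : 1 / (N : ℝ) ^ (2 * α) ≤ (24 ^ (1 / lam) + 1) * t := by
    rcases hcase with hlt | hγ1
    · have h1 : Nstar α γ N ^ (2 * α) ≤ (N : ℝ) ^ (2 * α) :=
        Real.rpow_le_rpow hN0.le (by linarith) (by linarith)
      have h2 := one_div_le_one_div_of_le (by positivity) h1
      linarith
    · have hT1 : 1 ≤ Tsum α lam γ := by
        have := rpow_weight_le_Tsum hγ hq ∅
        rwa [hγ1, Real.one_rpow] at this
      have h1 := inv_rpow_two_alpha_le hlam hq (N := N) (by omega)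
      have h2 : 1 / (N : ℝ) ^ (1 / lam) ≤ t := by
        rw [ht, Real.div_rpow hT.le hNp.le]
        gcongr
        exact Real.one_le_rpow hT1 (by positivity)
      have : 0 ≤ 24 ^ (1 / lam) * t := by positivity
      linarith
  have hN4 : (N : ℝ) ^ (4 * α) = ((N : ℝ) ^ (2 * α)) ^ 2 := by
    rw [← Real.rpow_natCast, ← Real.rpow_mul hNp.le]
    congr 1; push_cast; ring
  have hsecond : 16 * (1 / (N : ℝ) ^ (4 * α) * sqSum α γ)
      ≤ (t * (4 * (24 ^ (1 / lam) + 1) * √(sqSum α γ))) ^ 2 := by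
    have h1 : (t * (4 * (24 ^ (1 / lam) + 1) * √(sqSum α γ))) ^ 2
        = 16 * (((24 ^ (1 / lam) + 1) * t) ^ 2 * sqSum α γ) := by
      have := Real.sq_sqrt hS
      linear_combination (t * (4 * (24 ^ (1 / lam) + 1))) ^ 2 * this
    have h2 : 1 / (N : ℝ) ^ (4 * α) = (1 / (N : ℝ) ^ (2 * α)) ^ 2 := by
      rw [hN4, div_pow, one_pow]
    rw [h1, h2]
    gcongr
  have hc : 0 ≤ 48 / (2 - lam) * (24 : ℝ) ^ ((2 - lam) / lam) := by positivity
  refine Real.sqrt_le_iff.2 ⟨by positivity, ?_⟩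
  have hx : t ^ 2 * (48 / (2 - lam) * 24 ^ ((2 - lam) / lam))
      = (t * √(48 / (2 - lam) * 24 ^ ((2 - lam) / lam))) ^ 2 := by
    rw [mul_pow, Real.sq_sqrt hc]
  rw [hx] at hfirst
  rw [rSumBar, mul_add, mul_add]
  have h1 : 0 ≤ t * √(48 / (2 - lam) * 24 ^ ((2 - lam) / lam)) := by positivity
  have h2 : 0 ≤ t * (4 * (24 ^ (1 / lam) + 1) * √(sqSum α γ)) := by positivity
  nlinarith

lemma boundStar_eq {d : ℕ} (hd : 1 ≤ d) {α : ℝ} (hα : 0 < α) {γ : Finset (Fin d) → ℝ}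
    (hγ : IsWeight γ) {N : ℕ} (hN : 1 ≤ N) (f : UnitAddTorus (Fin d) → ℂ) :
    boundStar 200 1 α γ N f
      = normSqKor α γ f * (200 * (1 / Nstar α γ N ^ (2 * α) + √(rSumBar α γ N))) := by
  have hN1 := one_le_Nstar hd hα hγ hN
  have hN0 : 0 < Nstar α γ N := by linarith
  have h4 : Nstar α γ N ^ (4 * α) = (Nstar α γ N ^ (2 * α)) ^ 2 := by
    rw [← Real.rpow_natCast, ← Real.rpow_mul hN0.le]
    congr 1; push_cast; ring
  have h0 : 0 < Nstar α γ N ^ (2 * α) := by positivity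
  rw [boundStar, h4, Real.sqrt_mul (by positivity), Real.sqrt_sq h0.le]
  field_simp

lemma sqrt_sqSum_le_sqrt_rSumBar {d : ℕ} (hd : 1 ≤ d) {α : ℝ} (hα : 1 / 2 < α)
    {γ : Finset (Fin d) → ℝ} (hγ : IsWeight γ) {N : ℕ} (hN : 3 ≤ N) :
    √(sqSum α γ) / (N : ℝ) ^ (2 * α) ≤ √(rSumBar α γ N) := by
  have hN1 := one_le_Nstar hd (by linarith : 0 < α) hγ (N := N) (by omega)
  have hN3 : (3 : ℝ) ≤ N := by exact_mod_cast hN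
  have hNp : (0 : ℝ) < N := by linarith
  have hS := sqSum_nonneg hα γ
  have hI := integral_wcross_nonneg (α := α) γ (zero_le_one.trans hN1)
  have hN4 : (N : ℝ) ^ (4 * α) = ((N : ℝ) ^ (2 * α)) ^ 2 := by
    rw [← Real.rpow_natCast, ← Real.rpow_mul hNp.le]
    congr 1; push_cast; ring
  refine Real.le_sqrt_of_sq_le ?_
  rw [div_pow, Real.sq_sqrt hS, ← hN4, rSumBar, div_eq_mul_one_div, mul_comm]
  have h1 : 0 ≤ 4 * α / ((N : ℝ) - 1) := div_nonneg (by linarith) (by linarith)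
  have h2 : 0 ≤ 1 / (N : ℝ) ^ (4 * α) * sqSum α γ := by positivity
  have h3 := mul_nonneg h1 hI
  linarith

/-- The constant in the explicit bound. The first two terms bound the error itself, the last two the
square roots of the two parts of `r̄_sum`; positive for all arguments, also outside the range of `λ`. -/
noncomputable def explicitConst (α lam : ℝ) : ℝ :=
  200 * (24 ^ (1 / lam) + 2 ^ (2 * α) + √(48 / (2 - lam) * 24 ^ ((2 - lam) / lam))
    + 4 * (24 ^ (1 / lam) + 1))

lemma explicitConst_pos (α lam : ℝ) : 0 < explicitConst α lam := by
  unfold explicitConst; positivity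

lemma boundExplicit_eq {d : ℕ} {α lam : ℝ} {γ : Finset (Fin d) → ℝ} (hγ : IsWeight γ)
    (hq : 1 < 2 * α * lam) (D : ℝ) (N : ℕ) (f : UnitAddTorus (Fin d) → ℂ) :
    boundExplicit D 1 α lam γ N f = normSqKor α γ f * (D * (Tsum α lam γ / N) ^ (1 / lam) *
      (1 + √((N : ℝ) ^ (2 * α * lam - 1) * Tsum α lam γ + sqSum α γ))) := by
  rw [boundExplicit, Real.div_rpow (Tsum_pos hγ hq).le N.cast_nonneg, one_mul]
  ring

/-- The error satisfies the explicit bound even without its square root factor, and whatever the size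
of `N_*`. -/
lemma rate_le_boundExplicit {d : ℕ} (hd : 1 ≤ d) {α lam : ℝ} (hα : 0 < α)
    {γ : Finset (Fin d) → ℝ} (hγ : IsWeight γ) (hlam : 0 < lam) (hq : 1 < 2 * α * lam) {N : ℕ}
    (hN : 3 ≤ N) (f : UnitAddTorus (Fin d) → ℂ) :
    normSqKor α γ f * (200 * (1 / Nstar α γ N ^ (2 * α)
        + 2 ^ (2 * α) * Tsum α lam γ ^ (1 / lam) / (N : ℝ) ^ (2 * α)))
      ≤ boundExplicit (explicitConst α lam) 1 α lam γ N f := by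
  have hT := Tsum_pos hγ hq
  rw [boundExplicit_eq hγ hq]
  refine mul_le_mul_of_nonneg_left ?_ (normSqKor_nonneg hα hγ f)
  set t := (Tsum α lam γ / N) ^ (1 / lam) with ht
  have ht0 : 0 ≤ t := by positivity
  calc _ ≤ 200 * ((24 ^ (1 / lam) + 2 ^ (2 * α)) * t) :=
        mul_le_mul_of_nonneg_left (error_rate_le hd hα hγ hlam hq hN) (by norm_num)
    _ ≤ explicitConst α lam * t := by
        rw [← mul_assoc]
        refine mul_le_mul_of_nonneg_right ?_ ht0
        unfold explicitConst
        have : 0 ≤ √(48 / (2 - lam) * (24 : ℝ) ^ ((2 - lam) / lam)) := Real.sqrt_nonneg _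
        have : (0 : ℝ) ≤ 24 ^ (1 / lam) := by positivity
        linarith
    _ ≤ _ := le_mul_of_one_le_right (mul_nonneg (explicitConst_pos α lam).le ht0)
        (by linarith [Real.sqrt_nonneg ((N : ℝ) ^ (2 * α * lam - 1) * Tsum α lam γ + sqSum α γ)])

lemma boundStar_le_boundExplicit {d : ℕ} (hd : 1 ≤ d) {α lam : ℝ} (hα : 1 / 2 < α)
    {γ : Finset (Fin d) → ℝ} (hγ : IsWeight γ) (hlam : 0 < lam) (hlam2 : lam < 2)
    (hq : 1 < 2 * α * lam) {N : ℕ} (hN : 3 ≤ N)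
    (hcase : Nstar α γ N < (N : ℝ) / 2 ∨ γ ∅ = 1) (f : UnitAddTorus (Fin d) → ℂ) :
    boundStar 200 1 α γ N f ≤ boundExplicit (explicitConst α lam) 1 α lam γ N f := by
  have hα0 : 0 < α := by linarith
  have hT := Tsum_pos hγ hq
  rw [boundExplicit_eq hγ hq, boundStar_eq hd hα0 hγ (by omega)]
  refine mul_le_mul_of_nonneg_left ?_ (normSqKor_nonneg hα0 hγ f)
  have h1 := inv_Nstar_rpow_le hd hα0 hγ hlam hq hN
  have h2 := sqrt_rSumBar_le hd hα hγ hlam hlam2 hq hN hcase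
  set t := (Tsum α lam γ / N) ^ (1 / lam) with ht
  set c := √(48 / (2 - lam) * (24 : ℝ) ^ ((2 - lam) / lam)) with hc
  set b := (24 : ℝ) ^ (1 / lam) with hb
  set X := √((N : ℝ) ^ (2 * α * lam - 1) * Tsum α lam γ + sqSum α γ) with hX
  have ht0 : 0 ≤ t := by positivity
  have hc0 : 0 ≤ c := Real.sqrt_nonneg _
  have hb0 : 0 ≤ b := by positivity
  have hX0 : 0 ≤ X := Real.sqrt_nonneg _
  have hSX : √(sqSum α γ) ≤ X := Real.sqrt_le_sqrt (le_add_of_nonneg_left (by positivity))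
  have hp0 : (0 : ℝ) ≤ 2 ^ (2 * α) := by positivity
  calc 200 * (1 / Nstar α γ N ^ (2 * α) + √(rSumBar α γ N))
      ≤ 200 * (b * t + t * (c + 4 * (b + 1) * X)) := by
        have : t * (c + 4 * (b + 1) * √(sqSum α γ)) ≤ t * (c + 4 * (b + 1) * X) := by gcongr
        linarith
    _ ≤ 200 * ((b + 2 ^ (2 * α) + c + 4 * (b + 1)) * t * (1 + X)) := by
        have e : (b + 2 ^ (2 * α) + c + 4 * (b + 1)) * t * (1 + X)
            = (b * t + t * (c + 4 * (b + 1) * X))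
              + (t * (2 ^ (2 * α) + 4 * (b + 1)) + t * X * (b + 2 ^ (2 * α) + c)) := by ring
        have : 0 ≤ t * (2 ^ (2 * α) + 4 * (b + 1)) + t * X * (b + 2 ^ (2 * α) + c) := by positivity
        linarith
    _ = explicitConst α lam * t * (1 + X) := by
        rw [explicitConst, ← hc, ← hb]; ring

/-! ### Tractability and the conclusion -/

/-- An odd number of repetitions of order `log(N/ε) + d` suffices. -/
lemma exists_odd_RLarge : ∃ C : ℝ, 0 < C ∧ ∀ (d N : ℕ) (ε : ℝ), 3 ≤ N → 0 < ε → ε < 1 →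
    ∃ R : ℕ, Odd R ∧ RLarge d N R ε ∧ (R : ℝ) ≤ C * (Real.log (N / ε) + d) := by
  have hz := one_le_zetaR (q := 2) (by norm_num)
  have ha : 0 < Real.log (4 / 3) := Real.log_pos (by norm_num)
  have hb : 0 < Real.log 2 := Real.log_pos (by norm_num)
  have hc : 0 ≤ Real.log (1 + 2 * zetaR 2) / Real.log 2 :=
    div_nonneg (Real.log_nonneg (by linarith)) hb.le
  set c := Real.log (1 + 2 * zetaR 2) / Real.log 2 with hcdef
  refine ⟨4 / Real.log (4 / 3) + 4 / Real.log 2 + 3 + 2 * c, by positivity,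
    fun d N ε hN hε hε1 => ?_⟩
  have hN3 : (3 : ℝ) ≤ N := by exact_mod_cast hN
  have hNp : (0 : ℝ) < N := by linarith
  have hlε : Real.log ε ≤ 0 := Real.log_nonpos hε.le hε1.le
  have h3 : 1 ≤ Real.log 3 := by
    rw [Real.le_log_iff_exp_le (by norm_num)]
    linarith [Real.exp_one_lt_d9]
  have hlN : Real.log 3 ≤ Real.log N := Real.log_le_log (by norm_num) hN3
  have hl : Real.log (N / ε) = Real.log N - Real.log ε := Real.log_div hNp.ne' hε.ne'
  set l := Real.log (N / ε) with hldef
  have hl1 : 1 ≤ l := by linarith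
  have h1 : Real.log (3 * N / ε) / Real.log (4 / 3) ≤ 2 / Real.log (4 / 3) * l := by
    rw [div_mul_eq_mul_div]
    gcongr
    rw [Real.log_div (by positivity) hε.ne', Real.log_mul (by norm_num) hNp.ne']
    linarith
  have h2 : (Real.log (3 * (N : ℝ) ^ 2) - Real.log (4 * ε)) / Real.log 2 ≤ 2 / Real.log 2 * l := by
    rw [div_mul_eq_mul_div]
    gcongr
    rw [Real.log_mul (by norm_num) (by positivity), Real.log_mul (by norm_num) hε.ne', Real.log_pow]
    have : Real.log 3 ≤ Real.log 4 := Real.log_le_log (by norm_num) (by norm_num)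
    push_cast
    linarith
  have hd0 : (0 : ℝ) ≤ d := d.cast_nonneg
  have hp1 : 0 ≤ 2 / Real.log (4 / 3) * l := by positivity
  have hp2 : 0 ≤ 2 / Real.log 2 * l := by positivity
  have hp3 : 0 ≤ c * d := by positivity
  set ρ := max (Real.log (3 * N / ε) / Real.log (4 / 3))
      ((Real.log (3 * (N : ℝ) ^ 2) - Real.log (4 * ε)) / Real.log 2 + c * d) with hρ
  have hρle : ρ ≤ 2 / Real.log (4 / 3) * l + 2 / Real.log 2 * l + c * d :=
    max_le (by linarith) (by linarith)
  have hρ0 : 0 ≤ ρ := by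
    refine le_max_of_le_left (div_nonneg (Real.log_nonneg ?_) ha.le)
    rw [one_le_div hε]
    linarith
  refine ⟨2 * ⌈ρ⌉₊ + 1, ⟨_, rfl⟩, ?_, ?_⟩
  · change 2 * ρ ≤ ((2 * ⌈ρ⌉₊ + 1 : ℕ) : ℝ)
    push_cast
    linarith [Nat.le_ceil ρ]
  · push_cast
    have := Nat.ceil_lt_add_one hρ0
    have e : (4 / Real.log (4 / 3) + 4 / Real.log 2 + 3 + 2 * c) * (l + d)
        = 2 * (2 / Real.log (4 / 3) * l + 2 / Real.log 2 * l + c * d) + 3 * l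
          + (2 * c * l + (4 / Real.log (4 / 3) + 4 / Real.log 2 + 3) * d) := by ring
    have : 0 ≤ 2 * c * l + (4 / Real.log (4 / 3) + 4 / Real.log 2 + 3) * d := by positivity
    rw [e]
    linarith

/-- Choice of the number of points by Bertrand's postulate. -/
lemma exists_odd_prime_mem_Icc {x : ℝ} (hx : 3 ≤ x) :
    ∃ N : ℕ, N.Prime ∧ Odd N ∧ x ≤ N ∧ (N : ℝ) ≤ 4 * x := by
  have h0 : 3 ≤ ⌈x⌉₊ := by
    have := hx.trans (Nat.le_ceil x)
    exact_mod_cast this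
  obtain ⟨p, hp, h1, h2⟩ := Nat.exists_prime_lt_and_le_two_mul ⌈x⌉₊ (by omega)
  refine ⟨p, hp, hp.odd_of_ne_two (by omega), (Nat.le_ceil x).trans (by exact_mod_cast h1.le), ?_⟩
  have h3 : (p : ℝ) ≤ 2 * (⌈x⌉₊ : ℝ) := by exact_mod_cast h2
  have := Nat.ceil_lt_add_one (by linarith : 0 ≤ x)
  linarith

end MedianLattice

open MedianLattice
theorem mainTheorem2 :
    -- the two error bounds
    (∃ C₁ C₂ : ℝ, 0 < C₁ ∧ 0 < C₂ ∧ ∃ D₁ D₂ : ℝ → ℝ → ℝ,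
      (∀ α lam, 0 < D₁ α lam ∧ 0 < D₂ α lam) ∧
      ∀ (d : ℕ) (α : ℝ) (γ : Finset (Fin d) → ℝ) (N : ℕ),
        1 ≤ d → 1 / 2 < α → IsWeight γ → N.Prime → Odd N →
        ∀ f : UnitAddTorus (Fin d) → ℂ, MemKorobov α γ f →
          (∀ (ε : ℝ) (R : ℕ), 0 < ε → ε < 1 → Odd R → RLarge d N R ε →
            HoldsWithProb (law d N R) (1 - ε) fun ω =>
              SqErrorLE f N ω (boundStar C₁ C₂ α γ N f) ∧
              ∀ lam : ℝ, 1 / (2 * α) < lam → lam < 2 →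
                SqErrorLE f N ω (boundExplicit (D₁ α lam) (D₂ α lam) α lam γ N f)) ∧
          ((Nstar α γ N < (N : ℝ) / 2 ∨ γ ∅ = 1) →
            ∀ lam : ℝ, 1 / (2 * α) < lam → lam < 2 →
              boundStar C₁ C₂ α γ N f
                ≤ boundExplicit (D₁ α lam) (D₂ α lam) α lam γ N f)) ∧
    -- near-optimal rates for all smoothness parameters and weights
    (∀ (d : ℕ) (α : ℝ) (γ : Finset (Fin d) → ℝ) (δ : ℝ),
      1 ≤ d → 1 / 2 < α → IsWeight γ → 0 < δ →
      ∃ C : ℝ, 0 < C ∧ ∀ f : UnitAddTorus (Fin d) → ℂ, MemKorobov α γ f →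
        ∀ (ε : ℝ) (N R : ℕ), 0 < ε → ε < 1 → N.Prime → Odd N → Odd R → RLarge d N R ε →
          HoldsWithProb (law d N R) (1 - ε) fun ω =>
            SqErrorLE f N ω (normSqKor α γ f * (C / (N : ℝ) ^ (2 * (α - δ))))) ∧
    -- polynomial tractability
    (∀ (α lam q : ℝ) (γ : (d : ℕ) → Finset (Fin d) → ℝ),
      1 / 2 < α → 1 / (2 * α) < lam → lam < 2 → 0 < q → (∀ d, 1 ≤ d → IsWeight (γ d)) →
      (∃ B : ℝ, ∀ d : ℕ, 1 ≤ d → 1 / (d : ℝ) ^ q * Tsum α lam (γ d) ≤ B) →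
      (∃ B : ℝ, ∀ d : ℕ, 1 ≤ d →
        1 / (d : ℝ) ^ q * ∑ u : Finset (Fin d), sqTerm α (γ d) u ≤ B) →
      ∃ C p p' : ℝ, 0 < C ∧ 0 < p ∧ 0 < p' ∧
        ∀ (d : ℕ) (δ ε : ℝ), 1 ≤ d → 0 < δ → δ < 1 → 0 < ε → ε < 1 →
          ∃ N R : ℕ, N.Prime ∧ Odd N ∧ Odd R ∧ RLarge d N R ε ∧
            (N : ℝ) ≤ C * (d : ℝ) ^ p * (1 / δ) ^ p' ∧
            (R : ℝ) ≤ C * (Real.log (N / ε) + d) ∧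
            ∀ f : UnitAddTorus (Fin d) → ℂ, MemKorobov α (γ d) f → normSqKor α (γ d) f ≤ 1 →
              HoldsWithProb (law d N R) (1 - ε) fun ω => SqErrorLE f N ω (δ ^ 2)) := by
  refine ⟨⟨200, 1, by norm_num, one_pos, explicitConst, fun _ _ => 1,
    fun α lam => ⟨explicitConst_pos α lam, one_pos⟩, ?_⟩, ?_, ?_⟩
  · intro d α γ N hd hα hγ hN hodd f hf
    have hα0 : 0 < α := by linarith
    have hN3 := three_le_of_prime_of_odd hN hodd
    refine ⟨fun ε R hε _ hR hRl => ?_, fun hcase lam hlam hlam2 => ?_⟩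
    · refine (holdsWithProb_sqErrorLE_Nstar hd hα0 hγ hN hodd hf hε hR hRl).mono
        fun ω hω => ⟨?_, fun lam hlam _ => ?_⟩
      · refine (hω _ (fun u hu => weight_le_sqrt_sqSum hα hu) (by positivity)).mono ?_
        rw [boundStar_eq hd hα0 hγ (by omega), mul_div_cancel₀ _ (by positivity)]
        have h1 := sqrt_sqSum_le_sqrt_rSumBar hd hα hγ hN3
        have h2 := normSqKor_nonneg hα0 hγ f
        gcongr
      · obtain ⟨hl, hq⟩ := pos_and_one_lt_of_inv_lt hα0 hlam
        exact (hω _ (fun u _ => weight_le_Tsum_rpow hγ hl hq u)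
          (Real.rpow_nonneg (Tsum_pos hγ hq).le _)).mono
            (rate_le_boundExplicit hd hα0 hγ hl hq hN3 f)
    · obtain ⟨hl, hq⟩ := pos_and_one_lt_of_inv_lt hα0 hlam
      exact boundStar_le_boundExplicit hd hα hγ hl hlam2 hq hN3 hcase f
  · intro d α γ δ hd hα hγ hδ
    have hα0 : 0 < α := by linarith
    -- any `s < 2 α` with `s ≥ 2 (α - δ)` is a possible value of `1 / λ`
    set s := max (2 * (α - δ)) α with hs
    have hs0 : 0 < s := lt_max_of_lt_right hα0
    have hlam : 1 / (2 * α) < 1 / s :=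
      one_div_lt_one_div_of_lt hs0 (max_lt (by linarith) (by linarith))
    obtain ⟨hl, hq⟩ := pos_and_one_lt_of_inv_lt hα0 hlam
    have hT := Tsum_pos hγ hq
    refine ⟨200 * ((24 ^ s + 2 ^ (2 * α)) * Tsum α (1 / s) γ ^ s), by positivity,
      fun f hf ε N R hε _ hN hodd hR hRl => ?_⟩
    refine (holdsWithProb_sqErrorLE_rate hd hα0 hγ hN hodd hf hε hR hRl hlam).mono
      fun ω hω => hω.mono ?_
    have hN1 : (1 : ℝ) ≤ N := by exact_mod_cast hN.one_lt.le
    refine mul_le_mul_of_nonneg_left ?_ (normSqKor_nonneg hα0 hγ f)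
    rw [one_div_one_div, Real.div_rpow hT.le (by positivity), ← mul_div_assoc, ← mul_div_assoc]
    have : (N : ℝ) ^ (2 * (α - δ)) ≤ (N : ℝ) ^ s :=
      Real.rpow_le_rpow_of_exponent_le hN1 (le_max_left _ _)
    gcongr
  · rintro α lam q γ hα hlam - hq0 hγ ⟨B, hB⟩ -
    have hα0 : 0 < α := by linarith
    obtain ⟨hl, hq⟩ := pos_and_one_lt_of_inv_lt hα0 hlam
    obtain ⟨C, hC, hR⟩ := exists_odd_RLarge
    set D : ℝ := 200 * (24 ^ (1 / lam) + 2 ^ (2 * α)) with hD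
    have hD0 : 0 < D := by positivity
    -- for `N ≥ B D^λ d^q δ^{-2λ}` and `T ≤ B d^q` one has `D (T/N)^{1/λ} ≤ δ²`
    set A : ℝ := max 3 (B * D ^ lam) with hA
    have hA3 : 3 ≤ A := le_max_left _ _
    refine ⟨max C (4 * A), q, 2 * lam, lt_max_of_lt_left hC, hq0, by positivity,
      fun d δ ε hd hδ hδ1 hε hε1 => ?_⟩
    have hd1 : (1 : ℝ) ≤ d := by exact_mod_cast hd
    have hdq : 1 ≤ (d : ℝ) ^ q := Real.one_le_rpow hd1 hq0.le
    have hδq : 1 ≤ (1 / δ) ^ (2 * lam) :=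
      Real.one_le_rpow ((one_le_div hδ).2 hδ1.le) (by positivity)
    have hx : 3 ≤ A * (d : ℝ) ^ q * (1 / δ) ^ (2 * lam) :=
      hA3.trans ((le_mul_of_one_le_right (by linarith) hdq).trans
        (le_mul_of_one_le_right (by positivity) hδq))
    obtain ⟨N, hN, hodd, hxN, hNx⟩ := exists_odd_prime_mem_Icc hx
    have hN3 := three_le_of_prime_of_odd hN hodd
    obtain ⟨R, hRodd, hRl, hRC⟩ := hR d N ε hN3 hε hε1
    have hN3' : (3 : ℝ) ≤ N := by exact_mod_cast hN3
    have hlog : 0 ≤ Real.log (N / ε) + d :=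
      add_nonneg (Real.log_nonneg (by rw [one_le_div hε]; linarith)) (by linarith)
    refine ⟨N, R, hN, hodd, hRodd, hRl, ?_, ?_, fun f hf hf1 => ?_⟩
    · refine hNx.trans ?_
      rw [← mul_assoc, ← mul_assoc]
      have : 4 * A ≤ max C (4 * A) := le_max_right _ _
      gcongr
    · exact hRC.trans (mul_le_mul_of_nonneg_right (le_max_left _ _) hlog)
    · refine (holdsWithProb_sqErrorLE_rate hd hα0 (hγ d hd) hN hodd hf hε hRodd hRl hlam).mono
        fun ω hω => hω.mono ?_
      have hT := Tsum_pos (hγ d hd) hq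
      have hTN : D ^ lam * (Tsum α lam (γ d) / N) ≤ (δ ^ 2) ^ lam := by
        have h1 : Tsum α lam (γ d) ≤ B * (d : ℝ) ^ q := by
          have := hB d hd
          rwa [one_div_mul_eq_div, div_le_iff₀ (by positivity)] at this
        have h2 : (δ ^ 2) ^ lam * (1 / δ) ^ (2 * lam) = 1 := by
          rw [Real.rpow_mul (by positivity), ← Real.mul_rpow (by positivity) (by positivity),
            Real.rpow_two, ← mul_pow, mul_one_div_cancel hδ.ne', one_pow, Real.one_rpow]
        rw [← mul_div_assoc, div_le_iff₀ (by linarith)]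
        calc D ^ lam * Tsum α lam (γ d) ≤ D ^ lam * (B * (d : ℝ) ^ q) := by gcongr
          _ = B * D ^ lam * (d : ℝ) ^ q := by ring
          _ ≤ A * (d : ℝ) ^ q := by gcongr; exact le_max_right _ _
          _ = (δ ^ 2) ^ lam * (A * (d : ℝ) ^ q * (1 / δ) ^ (2 * lam)) := by
              linear_combination (-(A * (d : ℝ) ^ q)) * h2
          _ ≤ (δ ^ 2) ^ lam * N := by gcongr
      have h3 : D * (Tsum α lam (γ d) / N) ^ (1 / lam) ≤ δ ^ 2 := by
        have := Real.rpow_le_rpow (by positivity) hTN (by positivity : 0 ≤ lam⁻¹)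
        rwa [Real.mul_rpow (by positivity) (by positivity), Real.rpow_rpow_inv hD0.le hl.ne',
          Real.rpow_rpow_inv (by positivity) hl.ne', ← one_div] at this
      rw [← mul_assoc 200, ← hD]
      exact (mul_le_of_le_one_left (by positivity) hf1).trans h3
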